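/- Let $\Gamma_0$ be the Dynkin graph of an irreducible reduced crystallographic finite root system $\Delta^0$ with simple roots $\alpha_i$ ($i\in I_0$), let $\theta$ be its highest root, and let $\Gamma$ be the extended Dynkin graph, with vertex set $I=I_0\sqcup\{i_0\}$ and Cartan matrix $c_{ij}=\langle \alpha_j,\alpha_i^\vee\rangle$, where $\alpha_{i_0}$ is read as $-\theta$. Let $W$ be the affine Weyl group, i.e. the Coxeter group of $\Gamma$ with generators $s_i$ ($i\in I$) and length function $\ell$; it acts on configurations $v\in\mathbb R^I$, where $s_i$ acts by firing the vertex $i$: $v_j\mapsto v_j-c_{ij}v_i$ for all $j$. Let $W_0\subset W$ be the finite Weyl group, generated by the $s_i$ with $i\in I_0$. Define $\delta\in\mathbb Z^I$ by $\delta_{i_0}=1$ and $\theta=\sum_{i\in I_0}\delta_i\alpha_i$. A vertex $i\in I$ is called extending if removing it from $\Gamma$ leaves a Dynkin graph with respect to which $i$ is the extending vertex of $\Gamma$; for such $i$ let $\rho^{(i)}$ be the configuration with $\delta\cdot\rho^{(i)}=0$ and $\rho^{(i)}_j=1$ for all $j\ne i$. Let $W_0^{(i_0)}$ be the set of all $w\in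 W_0$ such that $w\rho^{(i_0)}$ is obtainable from $\rho^{(i_0)}$ by successively firing vertices of amplitude $<-1$ (amplitudes at the time of firing), ordered by: $w\le w'$ if $w'\rho^{(i_0)}$ is obtainable from $w\rho^{(i_0)}$ by firing vertices of amplitude $<-1$. Let $g\le_L h$ denote the left weak order on $W$: $\ell(h)=\ell(g)+\ell(hg^{-1})$. Then there is a well-defined injective map $\varphi: W_0^{(i_0)}\to W$ such that $\varphi(w)=s_{i_m}\cdots s_{i_1}$ for every sequence $i_1,\dots,i_m$ of firings of vertices of amplitude $<-1$ that leads from $\rho^{(i_0)}$ to $w\rho^{(i_0)}$; moreover $m=\ell(\varphi(w))$ for every such sequence, so that $W_0^{(i_0)}$ is graded by the number of firings and $\varphi$ takes this degree to the length. There is a greatest element $w^{\mathrm{top}}$ of $W_0^{(i_0)}$; it is the only element of maximal degree, and $w^{\mathrm{top}}\rho^{(i_0)}=-\rho^{(i)}$ for some extending vertex $i$. The map $\varphi$ is an isomorphism of posets from $W_0^{(i_0)}$ onto the interval $[1,\varphi(w^{\mathrm{top}})]$ of $(W,\le_L)$: its image is this interval, and $w\le w'$ if and only if $\varphi(w)\le_L\varphi(w')$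 for all $w,w'\in W_0^{(i_0)}$. -/

import Mathlib

open scoped BigOperators

/-! ### The numbers game on a graph with integral Cartan matrix `C` -/

namespace NumbersGame

section Game

variable {I : Type*}

/-- Firing the vertex `i`: `v` is replaced by `v j - c i j * v i` in coordinate `j`
(so `v i` becomes `-v i`, as `c i i = 2`, and only neighbours of `i` change besides). -/
def fire (C : Matrix I I ℤ) (i : I) (v : I → ℝ) : I → ℝ :=
  fun j => v j - (C i j : ℝ) * v i

/-- `StrictFiring C ω v v'`: the sequence of vertices `ω` (first entry fired first) can be fired
starting from `v`, each vertex having amplitude `< -1` when it is fired, and the final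
configuration is `v'`. -/
inductive StrictFiring (C : Matrix I I ℤ) : List I → (I → ℝ) → (I → ℝ) → Prop
  | nil (v : I → ℝ) : StrictFiring C [] v v
  | cons {i : I} {ω : List I} {v v' : I → ℝ} :
      v i < -1 → StrictFiring C ω (fire C i v) v' → StrictFiring C (i :: ω) v v'

/-- `v'` is obtainable from `v` by firing vertices of amplitude `< -1`. -/
def StrictlyObtainable (C : Matrix I I ℤ) (v v' : I → ℝ) : Prop :=
  ∃ ω : List I, StrictFiring C ω v v'

end Game

/-! ### The left weak order of a Coxeter system -/

section WeakOrder

variable {I W : Type*} [Group W] {M : CoxeterMatrix I}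

/-- The left weak order: `g ≤ h` iff `ℓ(h) = ℓ(g) + ℓ(h g⁻¹)`. -/
def LeftWeakLE (cs : CoxeterSystem M W) (g h : W) : Prop :=
  cs.length h = cs.length g + cs.length (h * g⁻¹)

/-- The interval `[g, h]` in the left weak order. -/
def leftWeakInterval (cs : CoxeterSystem M W) (g h : W) : Set W :=
  {x | LeftWeakLE cs g x ∧ LeftWeakLE cs x h}

end WeakOrder

/-! ### Extended Dynkin graphs and affine Weyl groups

The Dynkin graph `Γ₀` is the one of an irreducible finite root system `P` with base `b`; its vertex
set `I₀` is `b.support`. The extended graph `Γ` has vertex set `I = Option b.support`, the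
extending vertex `i₀` being `none`. -/

section Affine

variable {ι M N : Type*} [AddCommGroup M] [Module ℝ M] [AddCommGroup N] [Module ℝ N]
  {P : RootPairing ι ℝ M N}

/-- `θ` is the highest (longest, maximal) root with respect to `b`: its difference with any root is
a sum of simple roots. -/
def IsHighestRoot (b : P.Base) (θ : ι) : Prop :=
  ∀ k : ι, P.root θ - P.root k ∈ AddSubmonoid.closure (P.root '' b.support)

/-- The vertices of the extended Dynkin graph as roots of `P`, i.e. the simple affine roots
modulo the imaginary root: `i ∈ I₀` is the simple root `αᵢ`, and `i₀` is `-θ`. -/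
def extRoot (b : P.Base) (θ : ι) : Option b.support → ι
  | none => P.reflectionPerm θ θ
  | some i => i

/-- The Cartan matrix of the extended Dynkin graph, `c i j = ⟨αⱼ, αᵢ^∨⟩`. -/
noncomputable def extCartan [P.IsCrystallographic] (b : P.Base) (θ : ι) :
    Matrix (Option b.support) (Option b.support) ℤ :=
  Matrix.of fun i j => P.pairingIn ℤ (extRoot b θ j) (extRoot b θ i)

/-- The order `n` of `s_i s_j` as a function of `c i j * c j i = 4 cos²(π / n)`.
The value `0` stands for infinite order. -/
def coxeterOrder (x : ℤ) : ℕ :=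
  if x = 0 then 2 else if x = 1 then 3 else if x = 2 then 4 else if x = 3 then 6 else 0

theorem coxeterOrder_ne_one (x : ℤ) : coxeterOrder x ≠ 1 := by
  unfold coxeterOrder
  split_ifs <;> decide

open Classical in
/-- The Coxeter matrix of the extended Dynkin graph. -/
noncomputable def extCoxeterMatrix [P.IsCrystallographic] (b : P.Base) (θ : ι) :
    CoxeterMatrix (Option b.support) where
  M := Matrix.of fun i j =>
    if i = j then 1 else coxeterOrder (extCartan b θ i j * extCartan b θ j i)
  isSymm := by
    ext i j
    simp [Matrix.transpose_apply, eq_comm, mul_comm]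
  diagonal := by simp
  off_diagonal i j h := by
    simpa [h] using coxeterOrder_ne_one _

/-- The affine Weyl group `W`, as the Coxeter group of the extended Dynkin graph. -/
abbrev AffineWeylGroup [P.IsCrystallographic] (b : P.Base) (θ : ι) : Type _ :=
  (extCoxeterMatrix b θ).Group

/-- `W` with its simple reflections `s_i`, `i ∈ I`. -/
noncomputable abbrev affineSystem [P.IsCrystallographic] (b : P.Base) (θ : ι) :
    CoxeterSystem (extCoxeterMatrix b θ) (AffineWeylGroup b θ) :=
  (extCoxeterMatrix b θ).toCoxeterSystem

theorem extCartan_self [P.IsCrystallographic] (b : P.Base) (θ : ι) (i : Option b.support) :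
    extCartan b θ i i = 2 := by
  simp [extCartan]

theorem extCartan_eq_zero_symm [P.IsCrystallographic] (b : P.Base) (θ : ι)
    {i j : Option b.support} (h : extCartan b θ i j = 0) : extCartan b θ j i = 0 := by
  have := (P.pairingIn_eq_zero_iff (S := ℤ) (i := extRoot b θ j) (j := extRoot b θ i)).1 h
  exact this

theorem coord_extCartan [P.IsCrystallographic] (b : P.Base) (θ : ι) (i : Option b.support) :
    (LinearMap.proj i : (Option b.support → ℝ) →ₗ[ℝ] ℝ)
      (fun j => (extCartan b θ i j : ℝ)) = 2 := by
  simp [extCartan_self]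

/-- Firing `i` as a linear automorphism of the configuration space. -/
noncomputable def fireEquiv [P.IsCrystallographic] (b : P.Base) (θ : ι) (i : Option b.support) :
    (Option b.support → ℝ) ≃ₗ[ℝ] (Option b.support → ℝ) :=
  Module.reflection (coord_extCartan b θ i)

theorem fireEquiv_apply [P.IsCrystallographic] (b : P.Base) (θ : ι) (i : Option b.support)
    (v : Option b.support → ℝ) : fireEquiv b θ i v = fire (extCartan b θ) i v := by
  ext j
  simp [fireEquiv, fire, Module.reflection_apply, mul_comm]

theorem fireEquiv_isLiftable [P.IsCrystallographic] (b : P.Base) (θ : ι) :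
    (extCoxeterMatrix b θ).IsLiftable (fireEquiv b θ) := by
  intro i j
  by_cases hij : i = j
  · subst hij
    have hM : extCoxeterMatrix b θ i i = 1 := (extCoxeterMatrix b θ).diagonal i
    rw [hM, pow_one]
    ext v : 1
    exact Module.involutive_reflection (coord_extCartan b θ i) v
  have hM : extCoxeterMatrix b θ i j =
      coxeterOrder (extCartan b θ i j * extCartan b θ j i) := by
    simp [extCoxeterMatrix, hij]
  rw [hM]
  ext v : 1
  by_cases h0 : extCartan b θ i j * extCartan b θ j i = 0
  · have h1 : extCartan b θ i j = 0 := by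
      rcases mul_eq_zero.1 h0 with h | h
      · exact h
      · exact extCartan_eq_zero_symm b θ h
    have h2 := extCartan_eq_zero_symm b θ h1
    have := Module.reflection_mul_reflection_pow_apply (coord_extCartan b θ i)
      (coord_extCartan b θ j) 2 v (-2) (by simp [h1])
    rw [h0, coxeterOrder, if_pos rfl]
    rw [fireEquiv, fireEquiv, this]
    ext k
    simp [h1, h2]
    ring
  by_cases h3 : extCartan b θ i j * extCartan b θ j i = 1
  · have := Module.reflection_mul_reflection_pow_apply (coord_extCartan b θ i)
      (coord_extCartan b θ j) 3 v (-1)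
      (by
        have h3' : (extCartan b θ i j : ℝ) * extCartan b θ j i = 1 := by exact_mod_cast h3
        simp only [LinearMap.proj_apply]
        linarith)
    rw [h3, show coxeterOrder 1 = 3 from by decide]
    rw [fireEquiv, fireEquiv, this]
    norm_num
  by_cases h4 : extCartan b θ i j * extCartan b θ j i = 2
  · have := Module.reflection_mul_reflection_pow_apply (coord_extCartan b θ i)
      (coord_extCartan b θ j) 4 v 0
      (by
        have h3' : (extCartan b θ i j : ℝ) * extCartan b θ j i = 2 := by exact_mod_cast h4
        simp only [LinearMap.proj_apply]
        linarith)
    rw [h4, show coxeterOrder 2 = 4 from by decide]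
    rw [fireEquiv, fireEquiv, this]
    norm_num
  by_cases h6 : extCartan b θ i j * extCartan b θ j i = 3
  · have := Module.reflection_mul_reflection_pow_apply (coord_extCartan b θ i)
      (coord_extCartan b θ j) 6 v 1
      (by
        have h3' : (extCartan b θ i j : ℝ) * extCartan b θ j i = 3 := by exact_mod_cast h6
        simp only [LinearMap.proj_apply]
        linarith)
    rw [h6, show coxeterOrder 3 = 6 from by decide]
    have hS : ((Polynomial.Chebyshev.S ℝ 2).eval 1 : ℝ) = 0 := by
      norm_num [Polynomial.Chebyshev.S_two]
    rw [fireEquiv, fireEquiv, this]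
    norm_num [hS]
  · simp [coxeterOrder, h0, h3, h4, h6]

/-- The action of `W` on the configuration space `ℝ^I`, in which `s_i` acts by firing `i`. -/
noncomputable def affineRep [P.IsCrystallographic] (b : P.Base) (θ : ι) :
    AffineWeylGroup b θ →* ((Option b.support → ℝ) ≃ₗ[ℝ] (Option b.support → ℝ)) :=
  (affineSystem b θ).lift ⟨fireEquiv b θ, fireEquiv_isLiftable b θ⟩

theorem affineRep_simple [P.IsCrystallographic] (b : P.Base) (θ : ι) (i : Option b.support)
    (v : Option b.support → ℝ) :
    affineRep b θ ((affineSystem b θ).simple i) v = fire (extCartan b θ) i v := by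
  rw [affineRep, CoxeterSystem.lift_apply_simple, fireEquiv_apply]

/-- The vector `δ`: its `i₀`-coordinate is `1`, and on `I₀` its coordinates are those of the highest
root in the basis of simple roots. -/
noncomputable def delta [P.IsRootSystem] (b : P.Base) (θ : ι) : Option b.support → ℝ
  | none => 1
  | some i => b.toWeightBasis.repr (P.root θ) i

open Classical in
/-- The configuration `ρ^(i)` with `δ · ρ^(i) = 0` and all amplitudes outside `i` equal to `1`. -/
noncomputable def rho [P.IsRootSystem] (b : P.Base) (θ : ι) (i : Option b.support) :
    Option b.support → ℝ :=
  fun j => if j = i then -(∑ k ∈ Finset.univ.erase i, delta b θ k) / delta b θ i else 1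

/-- The vertex `i` is extending: removing it leaves the simple roots of a Dynkin graph (a base of
`P`) with respect to which `i` is the extending vertex (minus the highest root). -/
def IsExtending (b : P.Base) (θ : ι) (i : Option b.support) : Prop :=
  ∃ (b' : P.Base) (θ' : ι), IsHighestRoot b' θ' ∧
    (b'.support : Set ι) = extRoot b θ '' {j | j ≠ i} ∧
    P.root (extRoot b θ i) = -P.root θ'

/-- The finite Weyl group `W₀ ⊂ W`, generated by the `s_i` with `i ∈ I₀`. -/
noncomputable def finiteWeyl [P.IsCrystallographic] (b : P.Base) (θ : ι) : Subgroup (AffineWeylGroup b θ) :=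
  Subgroup.closure (Set.range fun i : b.support => (affineSystem b θ).simple (some i))

/-- The set `W₀^(i₀)` of those `w ∈ W₀` for which `w ρ^(i₀)` is obtainable from `ρ^(i₀)` by firing
vertices of amplitude `< -1`. (Firing vertices of `I₀` preserves `δ · v = 0`, so `w ρ^(i₀)` is
the configuration with `δ · v = 0` which extends `w ρ`, where `ρ = (1, …, 1)` on `I₀`.) -/
def finiteWeylPoset [P.IsCrystallographic] [P.IsRootSystem] (b : P.Base) (θ : ι) :
    Set (AffineWeylGroup b θ) :=
  {w | w ∈ finiteWeyl b θ ∧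
    StrictlyObtainable (extCartan b θ) (rho b θ none) (affineRep b θ w (rho b θ none))}

/-- The order on `W₀^(i₀)`: `w ≤ w'` iff `w' ρ^(i₀)` is obtainable from `w ρ^(i₀)` by firing vertices
of amplitude `< -1`. -/
def PosetLE [P.IsCrystallographic] [P.IsRootSystem] (b : P.Base) (θ : ι)
    (w w' : finiteWeylPoset b θ) : Prop :=
  StrictlyObtainable (extCartan b θ) (affineRep b θ w (rho b θ none))
    (affineRep b θ w' (rho b θ none))

end Affine

end NumbersGame

/-! Work with integer vectors on `I`, ordered coordinatewise; the affine roots are those whose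
finite part is a root, and `δ` spans the kernel of the finite part. Since `ρ` pairs to `1` with each
`α_j`, `j ∈ I₀`, and to `0` with `δ`, the amplitude of `i` at `xρ` is the height of the finite part
of `x⁻¹α_i` (`affineRep_rho_apply`).

The key object is the box: all `x ∈ W` with `0 ≤ xα_j ≤ δ` for every `j ∈ I₀`. Multiplying a box
element by `s_i` leaves the box only if some `xα_j` is `α_i` or `δ - α_i`, that is, at amplitude `1`
or `-1`. So firing an amplitude `< -1` stays in the box and raises the length
(`simple_mul_mem_boxSet`); conversely, each step down in the left weak order from a box element
reverses such a firing (`mem_boxSet_of_simple_mul_mem`). Thus the box is a lower set for `≤_L`, and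
the firing sequences from `ρ` are the reduced words of its elements.

Modulo `δ` the groups `W` and `W₀` act on roots by the same transformations, and box elements with
the same image of `ρ` differ by a translation, which the bounds exclude
(`eq_of_mem_boxSet_of_affineRep_eq`). Hence `x ↦ xρ` identifies the box with `W₀^(i₀)`, and `φ` is
the inverse identification.

If nothing can be fired at a box element, it sends the finite simple roots to the `δ - α_l`, where
`l` runs over all vertices but one, `i` (`exists_isTopForm`). This determines which roots become
positive, so there is only one such element (`IsTopForm.eq`), and every firing sequence in the
finite box can be continued to it. Its form forces `δ_i = 1`, which makes `i` extending.

Lengths enter through the criterion `ℓ(s_i g) > ℓ(g)` iff `g⁻¹α_i ≥ 0`, obtained by reduction to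
dihedral subgroups. -/

namespace NumbersGame

/-! ### Alternating products in a Coxeter group -/

section AltProd

variable {I W : Type*} [Group W] {M : CoxeterMatrix I} (cs : CoxeterSystem M W)

/-- The alternating product `s_a s_b s_a ⋯` with `k` factors. -/
def altProd (cs : CoxeterSystem M W) (a b : I) : ℕ → W
  | 0 => 1
  | k + 1 => cs.simple a * altProd cs b a k

theorem altProd_eq_inv_wordProd (a b : I) (k : ℕ) :
    altProd cs a b k = (cs.wordProd (CoxeterSystem.alternatingWord b a k))⁻¹ := by
  induction k generalizing a b with
  | zero => simp [altProd, CoxeterSystem.alternatingWord]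
  | succ k ih =>
    rw [altProd, ih, CoxeterSystem.alternatingWord_succ, cs.wordProd_concat, mul_inv_rev,
      cs.inv_simple]

theorem altProd_braid (a b : I) : altProd cs a b (M a b) = altProd cs b a (M a b) := by
  rw [altProd_eq_inv_wordProd, altProd_eq_inv_wordProd,
    cs.prod_alternatingWord_eq_prod_alternatingWord_sub a b (M a b) (by omega)]
  congr 3
  omega

theorem length_altProd_le (a b : I) (k : ℕ) : cs.length (altProd cs a b k) ≤ k := by
  rw [altProd_eq_inv_wordProd, cs.length_inv]
  exact (cs.length_wordProd_le _).trans (by simp)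

theorem exists_altProd_add (a b : I) (m j : ℕ) :
    ∃ z : W, cs.length z ≤ j ∧ altProd cs a b (m + j) = altProd cs a b m * z := by
  induction m generalizing a b with
  | zero => exact ⟨_, length_altProd_le cs a b j, by simp [altProd]⟩
  | succ m ih =>
    obtain ⟨z, hz, h⟩ := ih b a
    refine ⟨z, hz, ?_⟩
    rw [show m + 1 + j = (m + j) + 1 by omega, altProd, h, altProd, mul_assoc]

/-- If `b` is not a left descent of `u`, then `u` is an alternating product starting with `s_a`,
followed by an element without left descents among `a` and `b`. -/
theorem exists_eq_altProd_mul (u : W) (a b : I) (hb : ¬ cs.IsLeftDescent u b) :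
    ∃ (k : ℕ) (v : W), u = altProd cs a b k * v ∧ cs.length u = k + cs.length v ∧
      ¬ cs.IsLeftDescent v a ∧ ¬ cs.IsLeftDescent v b := by
  induction hn : cs.length u using Nat.strong_induction_on generalizing u a b with
  | _ n ih =>
    by_cases ha : cs.IsLeftDescent u a
    · have hl := cs.isLeftDescent_iff.1 ha
      obtain ⟨k, v, h1, h2, h3, h4⟩ := ih (cs.length (cs.simple a * u)) (by omega)
        (cs.simple a * u) b a (cs.isLeftDescent_iff_not_isLeftDescent_mul.1 ha) rfl
      refine ⟨k + 1, v, ?_, by omega, h4, h3⟩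
      rw [altProd, mul_assoc, ← h1, cs.simple_mul_simple_cancel_left]
    · exact ⟨0, u, by simp [altProd], by omega, ha, hb⟩

/-- With `k ≥ M a b` the braid relation would let the alternating product start with `s_b`, making
`b` a left descent. -/
theorem lt_of_not_isLeftDescent_altProd_mul {a b : I} {k : ℕ} {v : W}
    (hb : ¬ cs.IsLeftDescent (altProd cs a b k * v) b)
    (hl : cs.length (altProd cs a b k * v) = k + cs.length v) (hm : M a b ≠ 0) :
    k < M a b := by
  by_contra! hk
  obtain ⟨j, rfl⟩ := Nat.exists_eq_add_of_le hk
  obtain ⟨z, hz, h⟩ := exists_altProd_add cs a b (M a b) j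
  apply hb
  rw [CoxeterSystem.IsLeftDescent, hl]
  obtain ⟨m, hm'⟩ := Nat.exists_eq_succ_of_ne_zero hm
  have e : cs.simple b * (altProd cs a b (M a b + j) * v) = altProd cs a b m * z * v := by
    rw [h, altProd_braid, hm', Nat.succ_eq_add_one, altProd, ← mul_assoc, ← mul_assoc, ← mul_assoc,
      cs.simple_mul_simple_self, one_mul]
  rw [e]
  have h1 := cs.length_mul_le (altProd cs a b m * z) v
  have h2 := cs.length_mul_le (altProd cs a b m) z
  have h3 := length_altProd_le cs a b m
  omega

end AltProd

/-! ### The root representation -/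

section RootRefl

variable {I : Type*} [Fintype I] [DecidableEq I]

/-- The simple reflection `α_j ↦ α_j - c i j • α_i` of the root lattice `ℤ^I`. -/
def rootRefl (C : Matrix I I ℤ) (i : I) : Module.End ℤ (I → ℤ) where
  toFun β := β - (C i ⬝ᵥ β) • Pi.single i 1
  map_add' β γ := by rw [dotProduct_add, add_smul]; abel
  map_smul' c β := by
    rw [dotProduct_smul, smul_sub, RingHom.id_apply, smul_assoc]

theorem rootRefl_apply (C : Matrix I I ℤ) (i : I) (β : I → ℤ) :
    rootRefl C i β = β - (C i ⬝ᵥ β) • Pi.single i 1 := rfl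

theorem rootRefl_single (C : Matrix I I ℤ) (i j : I) :
    rootRefl C i (Pi.single j 1) = Pi.single j 1 - C i j • Pi.single i 1 := by
  simp [rootRefl_apply]

variable {W : Type*} [Group W] {M : CoxeterMatrix I} (cs : CoxeterSystem M W)
  {C : Matrix I I ℤ} {A : W →* Module.End ℤ (I → ℤ)}

theorem rep_inv_simple_mul_single (hA : ∀ i, A (cs.simple i) = rootRefl C i) (g : W) (i j : I) :
    A (cs.simple i * g)⁻¹ (Pi.single j 1) =
      A g⁻¹ (Pi.single j 1) - C i j • A g⁻¹ (Pi.single i 1) := by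
  rw [mul_inv_rev, cs.inv_simple, map_mul, hA, Module.End.mul_apply, rootRefl_single, map_sub,
    map_smul]

/-- A Chebyshev-type recursion; it couples the sequences starting with `a` and with `b`, because the
Cartan matrix need not be symmetric. -/
theorem rep_altProd_succ_succ (hA : ∀ i, A (cs.simple i) = rootRefl C i) (hC : ∀ i, C i i = 2)
    (v : W) (a b : I) (k : ℕ) :
    A (altProd cs a b (k + 2) * v)⁻¹ (Pi.single b 1) =
      (-C a b) • A (altProd cs b a (k + 1) * v)⁻¹ (Pi.single a 1) -
        A (altProd cs a b k * v)⁻¹ (Pi.single b 1) := by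
  rw [altProd, mul_assoc, rep_inv_simple_mul_single cs hA]
  have : A (altProd cs b a (k + 1) * v)⁻¹ (Pi.single b 1) =
      -A (altProd cs a b k * v)⁻¹ (Pi.single b 1) := by
    rw [altProd, mul_assoc, rep_inv_simple_mul_single cs hA, hC]
    module
  rw [this]
  module

theorem rep_altProd_one (hA : ∀ i, A (cs.simple i) = rootRefl C i) (v : W) (a b : I) :
    A (altProd cs a b 1 * v)⁻¹ (Pi.single b 1) =
      A v⁻¹ (Pi.single b 1) + (-C a b) • A v⁻¹ (Pi.single a 1) := by
  rw [altProd, altProd, mul_one, rep_inv_simple_mul_single cs hA]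
  module

/-- Nonnegativity of the coefficients of the roots of a dihedral group. -/
theorem dihedral_recursion_nonneg {p q : ℤ} (hp : 0 ≤ p) (hq : 0 ≤ q)
    {F G : ℕ → ℤ} (hF : 0 ≤ F 0) (hG : 0 ≤ G 0) (F1 : F 1 = F 0 + p * G 0)
    (G1 : G 1 = G 0 + q * F 0) (FS : ∀ k, F (k + 2) = p * G (k + 1) - F k)
    (GS : ∀ k, G (k + 2) = q * F (k + 1) - G k) (k : ℕ)
    (hk : coxeterOrder (p * q) ≠ 0 → k < coxeterOrder (p * q)) : 0 ≤ F k := by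
  obtain ⟨x, hx⟩ : ∃ x, x = p * q := ⟨_, rfl⟩
  rw [← hx] at hk
  have hx0 : 0 ≤ x := hx ▸ mul_nonneg hp hq
  have hpG := mul_nonneg hp hG
  -- Closed forms in `x = p * q`, up to index `5`: the largest finite order is `6`.
  have F2 : F 2 = p * G 0 + (x - 1) * F 0 := by rw [FS 0, G1, hx]; ring
  have G2 : G 2 = q * F 0 + (x - 1) * G 0 := by rw [GS 0, F1, hx]; ring
  have F3 : F 3 = (x - 1) * F 0 + (x - 2) * (p * G 0) := by rw [FS 1, G2, F1, hx]; ring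
  have G3 : G 3 = (x - 1) * G 0 + (x - 2) * (q * F 0) := by rw [GS 1, F2, G1, hx]; ring
  have F4 : F 4 = (x - 2) * (p * G 0) + (x ^ 2 - 3 * x + 1) * F 0 := by
    rw [FS 2, G3, F2, hx]; ring
  have G4 : G 4 = (x - 2) * (q * F 0) + (x ^ 2 - 3 * x + 1) * G 0 := by
    rw [GS 2, F3, G2, hx]; ring
  have F5 : F 5 = (x ^ 2 - 3 * x + 1) * F 0 + (x ^ 2 - 4 * x + 3) * (p * G 0) := by
    rw [FS 3, G4, F3, hx]; ring
  by_cases x0 : x = 0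
  · have : k < 2 := by simpa [coxeterOrder, x0] using hk
    interval_cases k <;> omega
  by_cases x1 : x = 1
  · have : k < 3 := by simpa [coxeterOrder, x1] using hk
    rw [x1] at F2
    interval_cases k <;> omega
  by_cases x2 : x = 2
  · have : k < 4 := by simpa [coxeterOrder, x2] using hk
    rw [x2] at F2 F3
    interval_cases k <;> omega
  by_cases x3 : x = 3
  · have : k < 6 := by simpa [coxeterOrder, x3] using hk
    rw [x3] at F2 F3 F4 F5
    interval_cases k <;> omega
  -- Infinite order, encoded as `0`: `hk` is vacuous and every `k` must be treated.
  have x4 : 4 ≤ p * q := by omega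
  have hp' : 0 < p := by
    rcases hp.lt_or_eq with h | h
    · exact h
    · rw [← h, zero_mul] at x4; omega
  have hq' : 0 < q := by
    rcases hq.lt_or_eq with h | h
    · exact h
    · rw [← h, mul_zero] at x4; omega
  -- The growth bounds reproduce themselves: `q * F (k + 2) = p * q * G (k + 1) - q * F k ≥ (p * q /
  -- 2) * G (k + 1)`, and `p * q ≥ 4`.
  have key : ∀ k, (0 ≤ F k ∧ 0 ≤ G k) ∧ 2 * G k ≤ q * F (k + 1) ∧ 2 * F k ≤ p * G (k + 1) := by
    intro k
    induction k with
    | zero =>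
      refine ⟨⟨hF, hG⟩, ?_, ?_⟩
      · rw [F1]; nlinarith [mul_nonneg hq hF]
      · rw [G1]; nlinarith
    | succ k ih =>
      obtain ⟨⟨h1, h2⟩, h3, h4⟩ := ih
      have e1 : 0 ≤ F (k + 1) := nonneg_of_mul_nonneg_right (by linarith) hq'
      have e2 : 0 ≤ G (k + 1) := nonneg_of_mul_nonneg_right (by linarith) hp'
      refine ⟨⟨e1, e2⟩, ?_, ?_⟩
      · rw [FS]
        nlinarith [mul_le_mul_of_nonneg_left h4 hq, mul_le_mul_of_nonneg_right x4 e2]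
      · rw [GS]
        nlinarith [mul_le_mul_of_nonneg_left h3 hp, mul_le_mul_of_nonneg_right x4 e1]
  exact (key k).1.1

/-- Roots obtained from two nonnegative roots by a dihedral element that does not
exceed the longest one are nonnegative. -/
theorem rep_altProd_nonneg (hA : ∀ i, A (cs.simple i) = rootRefl C i) (hC : ∀ i, C i i = 2)
    {a b : I} (hab : C a b ≤ 0) (hba : C b a ≤ 0)
    (hM : M a b = coxeterOrder (C a b * C b a)) (v : W)
    (ha : 0 ≤ A v⁻¹ (Pi.single a 1)) (hb : 0 ≤ A v⁻¹ (Pi.single b 1)) (k : ℕ)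
    (hk : M a b ≠ 0 → k < M a b) :
    0 ≤ A (altProd cs a b k * v)⁻¹ (Pi.single b 1) := by
  intro l
  rw [hM, ← neg_mul_neg] at hk
  exact dihedral_recursion_nonneg (p := -C a b) (q := -C b a)
    (F := fun k => A (altProd cs a b k * v)⁻¹ (Pi.single b 1) l)
    (G := fun k => A (altProd cs b a k * v)⁻¹ (Pi.single a 1) l)
    (by omega) (by omega)
    (by simp only [altProd, one_mul]; exact hb l) (by simp only [altProd, one_mul]; exact ha l)
    (by
      have := congrFun (rep_altProd_one cs hA v a b) l
      simpa only [altProd, one_mul, mul_one, Pi.add_apply, Pi.smul_apply, smul_eq_mul] using this)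
    (by
      have := congrFun (rep_altProd_one cs hA v b a) l
      simpa only [altProd, one_mul, mul_one, Pi.add_apply, Pi.smul_apply, smul_eq_mul] using this)
    (fun k => congrFun (rep_altProd_succ_succ cs hA hC v a b k) l)
    (fun k => congrFun (rep_altProd_succ_succ cs hA hC v b a k) l) k hk

/-- The root `w⁻¹ α_i` is nonnegative if `s_i` is not a left descent of `w`. -/
theorem rep_inv_single_nonneg (hA : ∀ i, A (cs.simple i) = rootRefl C i) (hC : ∀ i, C i i = 2)
    (hle : ∀ i j, i ≠ j → C i j ≤ 0)
    (hM : ∀ i j, i ≠ j → M i j = coxeterOrder (C i j * C j i)) (w : W) (i : I)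
    (hi : ¬ cs.IsLeftDescent w i) : 0 ≤ A w⁻¹ (Pi.single i 1) := by
  induction hn : cs.length w using Nat.strong_induction_on generalizing w i with
  | _ n ih =>
    by_cases hw : w = 1
    · simp [hw]
    obtain ⟨a, ha⟩ := cs.exists_leftDescent_of_ne_one hw
    have hai : a ≠ i := fun h => hi (h ▸ ha)
    obtain ⟨k, v, rfl, hl, hva, hvi⟩ := exists_eq_altProd_mul cs w a i hi
    -- This makes `v` strictly shorter than `w`, so induction applies to both `v⁻¹α_a` and `v⁻¹α_i`.
    have hk : k ≠ 0 := by
      rintro rfl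
      exact hva (by simpa [altProd] using ha)
    exact rep_altProd_nonneg cs hA hC (hle a i hai) (hle i a hai.symm)
      (hM a i hai) v (ih _ (by omega) v a hva rfl) (ih _ (by omega) v i hvi rfl) k
      (lt_of_not_isLeftDescent_altProd_mul cs hi hl)

end RootRefl

/-! ### Affine roots -/

section AffineRoots

open Classical

variable {ι M N : Type*} [AddCommGroup M] [Module ℝ M] [AddCommGroup N] [Module ℝ N]
  {P : RootPairing ι ℝ M N}

/-- The finite part of an element `∑ β_i α_i` of the affine root lattice. -/
noncomputable def finPart (b : P.Base) (θ : ι) : (Option b.support → ℤ) →ₗ[ℤ] M :=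
  Fintype.linearCombination ℤ fun i => P.root (extRoot b θ i)

/-- The coefficients of the imaginary root. -/
noncomputable def deltaInt (b : P.Base) (θ : ι) : Option b.support → ℤ
  | none => 1
  | some i => (b.exists_root_eq_sum_int θ).choose i

/-- The real affine roots (in coordinates): those with finite part a root. -/
def IsAffineRoot (b : P.Base) (θ : ι) (β : Option b.support → ℤ) : Prop :=
  finPart b θ β ∈ Set.range P.root

variable (b : P.Base) (θ : ι)

theorem deltaInt_none : deltaInt b θ none = 1 := rfl

theorem root_eq_sum_deltaInt :
    P.root θ = ∑ i : b.support, deltaInt b θ (some i) • P.root i := by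
  rw [(b.exists_root_eq_sum_int θ).choose_spec.2.2, ← Finset.sum_coe_sort]
  rfl

theorem delta_eq_deltaInt [P.IsRootSystem] (i : Option b.support) :
    delta b θ i = deltaInt b θ i := by
  cases i with
  | none => simp [delta, deltaInt]
  | some i =>
    have : P.root θ = ∑ i : b.support, (deltaInt b θ (some i) : ℝ) • b.toWeightBasis i := by
      simp_rw [b.toWeightBasis_apply, Int.cast_smul_eq_zsmul]
      exact root_eq_sum_deltaInt b θ
    rw [delta, this, Module.Basis.repr_sum_self]

theorem finPart_single (i : Option b.support) :
    finPart b θ (Pi.single i 1) = P.root (extRoot b θ i) := by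
  rw [finPart, Fintype.linearCombination_apply_single, one_smul]

theorem isAffineRoot_single (i : Option b.support) : IsAffineRoot b θ (Pi.single i 1) :=
  ⟨_, (finPart_single b θ i).symm⟩

theorem finPart_apply (β : Option b.support → ℤ) :
    finPart b θ β =
      ∑ i : b.support, (β (some i) - β none * deltaInt b θ (some i)) • P.root i := by
  rw [finPart, Fintype.linearCombination_apply, Fintype.sum_option]
  simp only [extRoot, P.root_reflectionPerm, P.reflection_apply_self]
  rw [root_eq_sum_deltaInt b θ, ← Finset.sum_neg_distrib, Finset.smul_sum,
    ← Finset.sum_add_distrib]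
  exact Finset.sum_congr rfl fun i _ => by module

theorem finPart_deltaInt : finPart b θ (deltaInt b θ) = 0 := by
  rw [finPart_apply]
  simp [deltaInt_none]

variable {b θ}

theorem coeff_eq_zero_of_sum_smul_root_eq_zero {n : b.support → ℤ}
    (h : ∑ i, n i • P.root i = 0) (i : b.support) : n i = 0 :=
  Fintype.linearIndependent_iff.1 (b.linearIndepOn_root.restrict_scalars' ℤ) n h i

theorem coeff_nonneg_of_mem_closure {n : b.support → ℤ}
    (h : ∑ i, n i • P.root i ∈ AddSubmonoid.closure (P.root '' b.support)) (i : b.support) :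
    0 ≤ n i := by
  rw [← Submodule.span_nat_eq_addSubmonoidClosure, Submodule.mem_toAddSubmonoid,
    Fintype.mem_span_image_iff_exists_fun] at h
  obtain ⟨c, hc⟩ := h
  have : c i = n i := Fintype.linearIndependent_iffₛ.mp
    (b.linearIndepOn_root.restrict_scalars' ℤ) (Int.ofNat ∘ c) n (by simpa) i
  omega

theorem sum_zsmul_mem_closure {G κ : Type*} [AddCommGroup G] (s : Set G) (t : Finset κ) (v : κ → G) (n : κ → ℤ)
    (hv : ∀ i ∈ t, v i ∈ s) (hn : ∀ i ∈ t, 0 ≤ n i) :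
    ∑ i ∈ t, n i • v i ∈ AddSubmonoid.closure s := by
  refine AddSubmonoid.sum_mem _ fun i hi => ?_
  obtain ⟨m, hm⟩ := Int.eq_ofNat_of_zero_le (hn i hi)
  rw [hm, natCast_zsmul]
  exact AddSubmonoid.nsmul_mem _ (AddSubmonoid.subset_closure (hv i hi)) m

theorem eq_smul_deltaInt_of_finPart_eq_zero {β : Option b.support → ℤ}
    (h : finPart b θ β = 0) : β = β none • deltaInt b θ := by
  rw [finPart_apply] at h
  ext i
  cases i with
  | none => simp [deltaInt_none]
  | some i =>
    have := coeff_eq_zero_of_sum_smul_root_eq_zero h i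
    simp only [Pi.smul_apply, smul_eq_mul]
    linarith

theorem IsAffineRoot.neg {β : Option b.support → ℤ} (h : IsAffineRoot b θ β) :
    IsAffineRoot b θ (-β) := by
  rw [IsAffineRoot, map_neg, P.neg_mem_range_root_iff]
  exact h

theorem IsAffineRoot.add_smul_deltaInt {β : Option b.support → ℤ} (h : IsAffineRoot b θ β) (m : ℤ) :
    IsAffineRoot b θ (β + m • deltaInt b θ) := by
  rwa [IsAffineRoot, map_add, map_smul, finPart_deltaInt, smul_zero, add_zero]

theorem IsAffineRoot.deltaInt_sub {β : Option b.support → ℤ} (h : IsAffineRoot b θ β) :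
    IsAffineRoot b θ (deltaInt b θ - β) := by
  have := h.neg.add_smul_deltaInt 1
  rwa [one_smul, neg_add_eq_sub] at this

theorem IsAffineRoot.ne_zero {β : Option b.support → ℤ} (h : IsAffineRoot b θ β) : β ≠ 0 := by
  rintro rfl
  obtain ⟨k, hk⟩ := h
  exact P.ne_zero k (by rw [hk, map_zero])

theorem IsAffineRoot.not_nonneg_and_nonpos {β : Option b.support → ℤ} (h : IsAffineRoot b θ β)
    (h1 : 0 ≤ β) (h2 : β ≤ 0) : False :=
  h.ne_zero (le_antisymm h2 h1)

/-- For `i ∈ I₀`, `θ - α_i` is a sum of simple roots. -/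
theorem one_le_deltaInt (hθ : IsHighestRoot b θ) (i : Option b.support) : 1 ≤ deltaInt b θ i := by
  cases i with
  | none => exact le_rfl
  | some i =>
    have := hθ i
    have e : P.root θ - P.root i =
        ∑ j, (deltaInt b θ (some j) - (Pi.single i 1 : b.support → ℤ) j) • P.root j := by
      simp_rw [sub_smul, Finset.sum_sub_distrib, ← root_eq_sum_deltaInt b θ]
      congr 1
      rw [Finset.sum_eq_single i] <;> simp +contextual
    rw [e] at this
    simpa using coeff_nonneg_of_mem_closure this i

theorem deltaInt_nonneg (hθ : IsHighestRoot b θ) : 0 ≤ deltaInt b θ :=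
  fun i => le_trans zero_le_one (one_le_deltaInt hθ i)

theorem IsAffineRoot.le_deltaInt (hθ : IsHighestRoot b θ) {β : Option b.support → ℤ}
    (h : IsAffineRoot b θ β) (h0 : β none = 0) : β ≤ deltaInt b θ := by
  obtain ⟨k, hk⟩ := h
  intro i
  cases i with
  | none => simp [h0, deltaInt_none]
  | some i =>
    have := hθ k
    rw [hk, finPart_apply, root_eq_sum_deltaInt b θ, ← Finset.sum_sub_distrib] at this
    simp_rw [← sub_smul, h0] at this
    have := coeff_nonneg_of_mem_closure this i
    linarith

theorem IsAffineRoot.nonneg_or_nonpos_of_none_eq_zero {β : Option b.support → ℤ}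
    (h : IsAffineRoot b θ β) (h0 : β none = 0) : 0 ≤ β ∨ β ≤ 0 := by
  obtain ⟨k, hk⟩ := h
  rw [finPart_apply] at hk
  refine (b.root_mem_or_neg_mem k).imp (fun h => ?_) (fun h => ?_)
  · rw [hk] at h
    intro i
    cases i with
    | none => exact h0.ge
    | some i => simpa [h0] using coeff_nonneg_of_mem_closure h i
  · rw [hk, ← Finset.sum_neg_distrib] at h
    simp_rw [← neg_smul] at h
    intro i
    cases i with
    | none => exact h0.le
    | some i => simpa [h0] using coeff_nonneg_of_mem_closure h i

/-- Subtracting `β none • δ` leaves a finite root, which lies between `-δ` and `δ`; hence the sign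
of `β none` decides unless it vanishes. -/
theorem IsAffineRoot.nonneg_or_nonpos (hθ : IsHighestRoot b θ) {β : Option b.support → ℤ}
    (h : IsAffineRoot b θ β) : 0 ≤ β ∨ β ≤ 0 := by
  have hγ := h.add_smul_deltaInt (-β none)
  have hγ0 : (β + (-β none) • deltaInt b θ) none = 0 := by simp [deltaInt_none]
  rcases lt_trichotomy (β none) 0 with hneg | hzero | hpos
  · right
    intro i
    have h1 := hγ.le_deltaInt hθ hγ0 i
    have h2 := one_le_deltaInt hθ i
    simp only [Pi.add_apply, Pi.smul_apply, smul_eq_mul] at h1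
    simp only [Pi.zero_apply]
    nlinarith
  · exact h.nonneg_or_nonpos_of_none_eq_zero hzero
  · left
    intro i
    have h1 := hγ.neg.le_deltaInt hθ (by rw [Pi.neg_apply, hγ0, neg_zero]) i
    have h2 := one_le_deltaInt hθ i
    simp only [Pi.add_apply, Pi.smul_apply, smul_eq_mul, Pi.neg_apply] at h1
    simp only [Pi.zero_apply]
    nlinarith

theorem IsAffineRoot.nonneg_of_pos (hθ : IsHighestRoot b θ) {β : Option b.support → ℤ}
    (h : IsAffineRoot b θ β) {i : Option b.support} (hi : 0 < β i) : 0 ≤ β :=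
  (h.nonneg_or_nonpos hθ).resolve_right fun h' => (h' i).not_gt hi

theorem IsAffineRoot.nonpos_of_neg (hθ : IsHighestRoot b θ) {β : Option b.support → ℤ}
    (h : IsAffineRoot b θ β) {i : Option b.support} (hi : β i < 0) : β ≤ 0 :=
  (h.nonneg_or_nonpos hθ).resolve_left fun h' => (h' i).not_gt hi

variable [P.IsCrystallographic]

theorem finPart_rootRefl (i : Option b.support) (β : Option b.support → ℤ) :
    finPart b θ (rootRefl (extCartan b θ) i β) = P.reflection (extRoot b θ i) (finPart b θ β) := by
  have : finPart b θ ∘ₗ rootRefl (extCartan b θ) i =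
      ((P.reflection (extRoot b θ i)).toLinearMap.restrictScalars ℤ) ∘ₗ finPart b θ := by
    refine LinearMap.pi_ext' fun j => LinearMap.ext_ring ?_
    simp only [LinearMap.coe_comp, Function.comp_apply, LinearMap.coe_single,
      LinearMap.coe_restrictScalars, LinearEquiv.coe_coe]
    rw [rootRefl_single, map_sub, map_smul, finPart_single, finPart_single,
      P.reflection_apply_root, ← P.algebraMap_pairingIn ℤ, extCartan, Matrix.of_apply,
      algebraMap_int_eq, eq_intCast, Int.cast_smul_eq_zsmul]
  exact LinearMap.congr_fun this β

theorem IsAffineRoot.rootRefl {β : Option b.support → ℤ} (h : IsAffineRoot b θ β)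
    (i : Option b.support) : IsAffineRoot b θ (rootRefl (extCartan b θ) i β) := by
  obtain ⟨k, hk⟩ := h
  exact ⟨P.reflectionPerm (extRoot b θ i) k, by
    rw [finPart_rootRefl, ← hk, P.root_reflectionPerm]⟩

/-- The root `s_i α_j` has coefficient `1` at `j` and `-c i j` at `i`, and a root has coefficients
of one sign. -/
theorem extCartan_nonpos (hθ : IsHighestRoot b θ) {i j : Option b.support} (hij : i ≠ j) :
    extCartan b θ i j ≤ 0 := by
  have h := (isAffineRoot_single b θ j).rootRefl i
  rw [rootRefl_single] at h
  have h1 := h.nonneg_of_pos hθ (i := j) (by simp [hij.symm]) i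
  simpa [hij] using h1

theorem rootRefl_deltaInt (i : Option b.support) :
    rootRefl (extCartan b θ) i (deltaInt b θ) = deltaInt b θ := by
  have h := finPart_rootRefl (b := b) (θ := θ) i (deltaInt b θ)
  rw [rootRefl_apply, map_sub, map_smul, finPart_deltaInt, map_zero, zero_sub, finPart_single,
    neg_eq_zero] at h
  have : extCartan b θ i ⬝ᵥ deltaInt b θ = 0 := by
    rw [← Int.cast_smul_eq_zsmul ℝ] at h
    exact_mod_cast (smul_eq_zero.1 h).resolve_right (P.ne_zero _)
  rw [rootRefl_apply, this, zero_smul, sub_zero]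

/-! ### The action of the affine Weyl group on the root lattice -/

/-- The pairing of the root lattice with configurations. -/
noncomputable def latticePairing (β : Option b.support → ℤ) (v : Option b.support → ℝ) : ℝ :=
  ∑ i, (β i : ℝ) * v i

omit [P.IsCrystallographic] in
theorem latticePairing_single (i : Option b.support) (v : Option b.support → ℝ) :
    latticePairing (Pi.single i 1) v = v i := by
  rw [latticePairing, Finset.sum_eq_single i] <;> simp +contextual

omit [P.IsCrystallographic] in
theorem latticePairing_injective {β γ : Option b.support → ℤ}
    (h : ∀ v, latticePairing β v = latticePairing γ v) : β = γ := by
  ext i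
  have := h (Pi.single i 1)
  simp only [latticePairing] at this
  rw [Finset.sum_eq_single i, Finset.sum_eq_single i] at this <;> simp_all

theorem latticePairing_rootRefl (i : Option b.support) (β : Option b.support → ℤ)
    (v : Option b.support → ℝ) :
    latticePairing (rootRefl (extCartan b θ) i β) v = latticePairing β (fireEquiv b θ i v) := by
  rw [fireEquiv_apply]
  simp only [latticePairing, fire, rootRefl_apply, Pi.sub_apply, Pi.smul_apply, smul_eq_mul,
    Int.cast_sub, Int.cast_mul, sub_mul, mul_sub, Finset.sum_sub_distrib]
  congr 1
  rw [Finset.sum_eq_single i]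
  · simp only [dotProduct, Pi.single_eq_same, Int.cast_one, mul_one, Int.cast_sum, Int.cast_mul,
      Finset.sum_mul]
    exact Finset.sum_congr rfl fun j _ => by ring
  · intro j _ hj
    simp [hj]
  · simp

theorem latticePairing_rootRefl_mul_pow (i j : Option b.support) (n : ℕ)
    (β : Option b.support → ℤ) (v : Option b.support → ℝ) :
    latticePairing (((rootRefl (extCartan b θ) i * rootRefl (extCartan b θ) j) ^ n) β) v =
      latticePairing β (((fireEquiv b θ j * fireEquiv b θ i) ^ n) v) := by
  induction n generalizing v with
  | zero => simp
  | succ n ih =>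
    rw [pow_succ', Module.End.mul_apply, Module.End.mul_apply, latticePairing_rootRefl,
      latticePairing_rootRefl, ih, pow_succ]
    rfl

/-- The Coxeter relations come by duality from the firing action; transposing swaps `i` and `j`,
hence the symmetry of the Coxeter matrix. -/
theorem rootRefl_isLiftable :
    (extCoxeterMatrix b θ).IsLiftable (rootRefl (extCartan b θ)) := by
  intro i j
  refine LinearMap.ext fun β => latticePairing_injective fun v => ?_
  rw [latticePairing_rootRefl_mul_pow, (extCoxeterMatrix b θ).symmetric,
    fireEquiv_isLiftable b θ j i]
  rfl

variable (b θ) in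
/-- The action of the affine Weyl group on the root lattice. -/
noncomputable def rootRep : AffineWeylGroup b θ →* Module.End ℤ (Option b.support → ℤ) :=
  (affineSystem b θ).lift ⟨rootRefl (extCartan b θ), rootRefl_isLiftable⟩

theorem rootRep_simple (i : Option b.support) :
    rootRep b θ ((affineSystem b θ).simple i) = rootRefl (extCartan b θ) i := by
  rw [rootRep, CoxeterSystem.lift_apply_simple]

theorem rootRep_mul_apply (g h : AffineWeylGroup b θ) (β : Option b.support → ℤ) :
    rootRep b θ (g * h) β = rootRep b θ g (rootRep b θ h β) := by
  rw [map_mul, Module.End.mul_apply]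

theorem rootRep_inv_apply_self (g : AffineWeylGroup b θ) (β : Option b.support → ℤ) :
    rootRep b θ g⁻¹ (rootRep b θ g β) = β := by
  rw [← rootRep_mul_apply, inv_mul_cancel, map_one, Module.End.one_apply]

theorem rootRep_apply_inv_self (g : AffineWeylGroup b θ) (β : Option b.support → ℤ) :
    rootRep b θ g (rootRep b θ g⁻¹ β) = β := by
  rw [← rootRep_mul_apply, mul_inv_cancel, map_one, Module.End.one_apply]

theorem latticePairing_rootRep (g : AffineWeylGroup b θ) (β : Option b.support → ℤ)
    (v : Option b.support → ℝ) :
    latticePairing (rootRep b θ g β) (affineRep b θ g v) = latticePairing β v := by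
  induction g using (affineSystem b θ).simple_induction_left with
  | one => simp
  | mul_simple_left g i ih =>
    rw [map_mul, map_mul, Module.End.mul_apply, rootRep_simple, latticePairing_rootRefl,
      LinearEquiv.mul_apply, affineRep_simple, ← fireEquiv_apply,
      show fireEquiv b θ i (fireEquiv b θ i (affineRep b θ g v)) = affineRep b θ g v from
        Module.involutive_reflection (coord_extCartan b θ i) _, ih]

/-- Translates amplitudes of configurations into statements about roots. -/
theorem affineRep_apply (g : AffineWeylGroup b θ) (v : Option b.support → ℝ)
    (i : Option b.support) :
    affineRep b θ g v i = latticePairing (rootRep b θ g⁻¹ (Pi.single i 1)) v := by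
  rw [← latticePairing_rootRep g, rootRep_apply_inv_self, latticePairing_single]

theorem rootRep_deltaInt (g : AffineWeylGroup b θ) :
    rootRep b θ g (deltaInt b θ) = deltaInt b θ := by
  induction g using (affineSystem b θ).simple_induction_left with
  | one => simp
  | mul_simple_left g i ih => rw [rootRep_mul_apply, ih, rootRep_simple, rootRefl_deltaInt]

theorem IsAffineRoot.rootRep {β : Option b.support → ℤ} (h : IsAffineRoot b θ β)
    (g : AffineWeylGroup b θ) : IsAffineRoot b θ (rootRep b θ g β) := by
  induction g using (affineSystem b θ).simple_induction_left with
  | one => simpa using h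
  | mul_simple_left g i ih =>
    rw [rootRep_mul_apply, rootRep_simple]
    exact ih.rootRefl i

theorem isAffineRoot_rootRep_single (g : AffineWeylGroup b θ) (i : Option b.support) :
    IsAffineRoot b θ (NumbersGame.rootRep b θ g (Pi.single i 1)) :=
  (isAffineRoot_single b θ i).rootRep g

theorem rootRep_inv_simple_mul_single (g : AffineWeylGroup b θ) (i : Option b.support) :
    rootRep b θ ((affineSystem b θ).simple i * g)⁻¹ (Pi.single i 1) =
      -rootRep b θ g⁻¹ (Pi.single i 1) := by
  rw [rep_inv_simple_mul_single (affineSystem b θ) rootRep_simple, extCartan_self]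
  module

theorem rootRep_inv_single_nonneg (hθ : IsHighestRoot b θ) {g : AffineWeylGroup b θ}
    {i : Option b.support} (h : ¬ (affineSystem b θ).IsLeftDescent g i) :
    0 ≤ rootRep b θ g⁻¹ (Pi.single i 1) :=
  rep_inv_single_nonneg (affineSystem b θ) rootRep_simple (extCartan_self b θ)
    (fun _ _ => extCartan_nonpos hθ) (fun i j hij => by simp [extCoxeterMatrix, hij]) g i h

/-- For the converse, pass to `s_i g`: its root is the negative one, and no root is both nonnegative
and nonpositive. -/
theorem length_simple_mul_eq_iff (hθ : IsHighestRoot b θ) {g : AffineWeylGroup b θ}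
    {i : Option b.support} :
    (affineSystem b θ).length ((affineSystem b θ).simple i * g) =
      (affineSystem b θ).length g + 1 ↔ 0 ≤ rootRep b θ g⁻¹ (Pi.single i 1) := by
  rw [← (affineSystem b θ).not_isLeftDescent_iff]
  refine ⟨rootRep_inv_single_nonneg hθ, fun h h' => ?_⟩
  have h1 := rootRep_inv_single_nonneg hθ ((affineSystem b θ).isLeftDescent_iff_not_isLeftDescent_mul.1 h')
  rw [rootRep_inv_simple_mul_single] at h1
  exact (isAffineRoot_rootRep_single _ i).not_nonneg_and_nonpos h (neg_nonneg.1 h1)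

theorem eq_one_of_rootRep_nonneg (hθ : IsHighestRoot b θ) {g : AffineWeylGroup b θ}
    (h : ∀ i, 0 ≤ rootRep b θ g (Pi.single i 1)) : g = 1 := by
  by_contra hg
  obtain ⟨i, hi⟩ := (affineSystem b θ).exists_leftDescent_of_ne_one (inv_ne_one.2 hg)
  refine ((affineSystem b θ).not_isLeftDescent_iff.2 ((length_simple_mul_eq_iff hθ).2 ?_)) hi
  simpa using h i

/-- `s_i` changes only the coefficient at `i`, so `β` is a multiple of `α_i`; reducedness makes the
factor `1`. -/
theorem eq_single_of_rootRefl_nonpos [P.IsReduced]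
    {β : Option b.support → ℤ} (h : IsAffineRoot b θ β) (h0 : 0 ≤ β) {i : Option b.support}
    (hi : rootRefl (extCartan b θ) i β ≤ 0) : β = Pi.single i 1 := by
  have e : β = β i • Pi.single i 1 := by
    ext j
    by_cases hj : j = i
    · subst hj; simp
    · have h1 := hi j
      simp only [rootRefl_apply, Pi.sub_apply, Pi.smul_apply, Pi.single_eq_of_ne hj, smul_zero,
        sub_zero] at h1 ⊢
      exact le_antisymm h1 (h0 j)
  obtain ⟨k, hk⟩ := h
  rw [e, map_smul, finPart_single] at hk
  have hne : β i ≠ 0 := by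
    intro h
    rw [h, zero_smul] at hk
    exact P.ne_zero k hk
  have hi0 : 0 ≤ β i := h0 i
  have hdep : ¬ LinearIndependent ℝ ![P.root k, P.root (extRoot b θ i)] := by
    simp only [LinearIndependent.pair_iff, not_forall]
    exact ⟨-1, β i, by rw [hk, Int.cast_smul_eq_zsmul]; module, by simp⟩
  have hfac : ∀ c : ℤ, P.root k = c • P.root (extRoot b θ i) → β i = c := by
    intro c hc
    rw [hc, ← Int.cast_smul_eq_zsmul ℝ, ← Int.cast_smul_eq_zsmul ℝ] at hk
    exact_mod_cast (smul_left_injective ℝ (P.ne_zero _) hk).symm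
  rcases RootPairing.IsReduced.eq_or_eq_neg (P := P) k _ hdep with h1 | h1
  · rw [e, hfac 1 (by rw [h1, one_smul]), one_smul]
  · have := hfac (-1) (by rw [h1, neg_one_smul])
    omega

end AffineRoots

/-! ### Elements mapping the simple finite roots between `0` and `δ` -/

section Box

open Classical

variable {ι M N : Type*} [AddCommGroup M] [Module ℝ M] [AddCommGroup N] [Module ℝ N]
  {P : RootPairing ι ℝ M N}

/-- The coefficients of the finite part with respect to the simple roots. -/
noncomputable def finCoeff (b : P.Base) (θ : ι) (β : Option b.support → ℤ) (j : b.support) : ℤ :=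
  β (some j) - β none * deltaInt b θ (some j)

/-- The height of the finite part. -/
noncomputable def finHeight (b : P.Base) (θ : ι) : (Option b.support → ℤ) →ₗ[ℤ] ℤ :=
  ∑ j : b.support, (LinearMap.proj (some j) - deltaInt b θ (some j) • LinearMap.proj none)

variable {b : P.Base} {θ : ι}

theorem finHeight_apply (β : Option b.support → ℤ) :
    finHeight b θ β = ∑ j, finCoeff b θ β j := by
  simp [finHeight, finCoeff, mul_comm]

theorem finPart_eq_sum_finCoeff (β : Option b.support → ℤ) :
    finPart b θ β = ∑ j : b.support, finCoeff b θ β j • P.root j := finPart_apply b θ β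

theorem finCoeff_single (i j : b.support) :
    finCoeff b θ (Pi.single (some i) 1) j = (Pi.single i 1 : b.support → ℤ) j := by
  simp [finCoeff, Pi.single_apply]

theorem finHeight_single (i : b.support) : finHeight b θ (Pi.single (some i) 1) = 1 := by
  simp [finHeight_apply, finCoeff_single]

theorem finCoeff_deltaInt (j : b.support) : finCoeff b θ (deltaInt b θ) j = 0 := by
  simp [finCoeff, deltaInt_none]

theorem finHeight_deltaInt : finHeight b θ (deltaInt b θ) = 0 := by
  simp [finHeight_apply, finCoeff_deltaInt]

theorem finCoeff_sum_smul {κ : Type*} (s : Finset κ) (c : κ → ℤ) (f : κ → Option b.support → ℤ)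
    (j : b.support) :
    finCoeff b θ (∑ l ∈ s, c l • f l) j = ∑ l ∈ s, c l * finCoeff b θ (f l) j := by
  simp only [finCoeff, Finset.sum_apply, Pi.smul_apply, smul_eq_mul, Finset.sum_mul, mul_sub,
    Finset.sum_sub_distrib, mul_assoc]

theorem eq_sum_finCoeff (β : Option b.support → ℤ) :
    β = ∑ j : b.support, finCoeff b θ β j • Pi.single (some j) 1 + β none • deltaInt b θ := by
  ext i
  cases i with
  | none => simp [deltaInt_none, Finset.sum_apply]
  | some i =>
    simp only [Pi.add_apply, Finset.sum_apply, Pi.smul_apply, smul_eq_mul]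
    rw [Finset.sum_eq_single i]
    · simp [finCoeff]
    · intro j _ hj
      simp [hj.symm]
    · simp

theorem rho_none_none [P.IsRootSystem] :
    rho b θ none none = -∑ j : b.support, (deltaInt b θ (some j) : ℝ) := by
  have h := Finset.sum_erase_add (s := Finset.univ) (fun k => delta b θ k)
    (Finset.mem_univ (none : Option b.support))
  rw [Fintype.sum_option] at h
  have h1 : delta b θ none = 1 := rfl
  simp_rw [← delta_eq_deltaInt]
  simp only [rho, if_true]
  rw [h1, div_one]
  linarith

theorem latticePairing_rho_none [P.IsRootSystem] (β : Option b.support → ℤ) :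
    latticePairing β (rho b θ none) = finHeight b θ β := by
  rw [latticePairing, Fintype.sum_option, rho_none_none, finHeight_apply]
  simp only [finCoeff, rho, reduceCtorEq, if_false, mul_one]
  push_cast
  rw [Finset.sum_sub_distrib, mul_neg, Finset.mul_sum]
  ring

theorem IsAffineRoot.finCoeff_nonneg_or_nonpos {β : Option b.support → ℤ}
    (h : IsAffineRoot b θ β) : (∀ j, 0 ≤ finCoeff b θ β j) ∨ ∀ j, finCoeff b θ β j ≤ 0 := by
  have h1 := h.add_smul_deltaInt (-β none)
  have e (j : b.support) : (β + (-β none) • deltaInt b θ) (some j) = finCoeff b θ β j := by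
    simp only [finCoeff, Pi.add_apply, Pi.smul_apply, smul_eq_mul]; ring
  refine (h1.nonneg_or_nonpos_of_none_eq_zero (by simp [deltaInt_none])).imp
    (fun h2 j => ?_) (fun h2 j => ?_)
  · exact e j ▸ h2 (some j)
  · exact e j ▸ h2 (some j)

/-- The finite coefficients have one sign, so height zero would make the finite part zero.
Amplitudes at `xρ` are therefore never `0`. -/
theorem IsAffineRoot.finHeight_ne_zero {β : Option b.support → ℤ}
    (h : IsAffineRoot b θ β) : finHeight b θ β ≠ 0 := by
  intro h0
  rw [finHeight_apply] at h0
  have hz : ∀ j, finCoeff b θ β j = 0 := by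
    rcases h.finCoeff_nonneg_or_nonpos with h1 | h1
    · exact fun j => (Finset.sum_eq_zero_iff_of_nonneg fun j _ => h1 j).1 h0 j (Finset.mem_univ j)
    · exact fun j => (Finset.sum_eq_zero_iff_of_nonpos fun j _ => h1 j).1 h0 j (Finset.mem_univ j)
  obtain ⟨k, hk⟩ := h
  refine P.ne_zero k ?_
  rw [hk, finPart_eq_sum_finCoeff]
  simp [hz]

theorem IsAffineRoot.finCoeff_nonneg {β : Option b.support → ℤ}
    (h : IsAffineRoot b θ β) (h0 : 0 < finHeight b θ β) (j : b.support) :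
    0 ≤ finCoeff b θ β j :=
  h.finCoeff_nonneg_or_nonpos.resolve_right
    (fun h1 => (Finset.sum_nonpos fun j _ => h1 j).not_gt (finHeight_apply β ▸ h0)) j

/-- A root whose finite part has height `1` is a simple root modulo `δ`. -/
theorem IsAffineRoot.eq_single_add_of_finHeight_eq_one {β : Option b.support → ℤ}
    (h : IsAffineRoot b θ β) (h1 : finHeight b θ β = 1) :
    ∃ j : b.support, β = Pi.single (some j) 1 + β none • deltaInt b θ := by
  have hn := h.finCoeff_nonneg (by omega)
  obtain ⟨j, -, hj⟩ : ∃ j ∈ Finset.univ, finCoeff b θ β j ≠ 0 :=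
    Finset.exists_ne_zero_of_sum_ne_zero (by rw [← finHeight_apply, h1]; exact one_ne_zero)
  refine ⟨j, ?_⟩
  have hs := Finset.add_sum_erase Finset.univ (finCoeff b θ β) (Finset.mem_univ j)
  have hr : 0 ≤ ∑ k ∈ Finset.univ.erase j, finCoeff b θ β k := Finset.sum_nonneg fun k _ => hn k
  rw [← finHeight_apply, h1] at hs
  have hj1 := hn j
  have hz : ∀ k ∈ Finset.univ.erase j, finCoeff b θ β k = 0 :=
    (Finset.sum_eq_zero_iff_of_nonneg fun k _ => hn k).1 (by omega)
  conv_lhs => rw [eq_sum_finCoeff (θ := θ) β]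
  rw [← Finset.add_sum_erase _ _ (Finset.mem_univ j), Finset.sum_eq_zero fun k hk => by
    rw [hz k hk, zero_smul], add_zero, show finCoeff b θ β j = 1 by
      have := Finset.sum_eq_zero hz; omega, one_smul]

variable [P.IsCrystallographic]

variable (b θ) in
/-- The elements of `W` that map all simple roots of `Γ₀` between `0` and `δ`. -/
def boxSet : Set (AffineWeylGroup b θ) :=
  {x | ∀ j : b.support, 0 ≤ rootRep b θ x (Pi.single (some j) 1) ∧
    rootRep b θ x (Pi.single (some j) 1) ≤ deltaInt b θ}

theorem one_mem_boxSet (hθ : IsHighestRoot b θ) : 1 ∈ boxSet b θ := by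
  intro j
  rw [map_one, Module.End.one_apply]
  exact ⟨by simp, (isAffineRoot_single b θ (some j)).le_deltaInt hθ (by simp)⟩

theorem rootRep_eq_sum_finCoeff (x : AffineWeylGroup b θ) (β : Option b.support → ℤ) :
    rootRep b θ x β = ∑ j : b.support, finCoeff b θ β j • rootRep b θ x (Pi.single (some j) 1) +
      β none • deltaInt b θ := by
  conv_lhs => rw [eq_sum_finCoeff (θ := θ) β]
  rw [map_add, map_smul, rootRep_deltaInt, map_sum]
  simp_rw [map_smul]

theorem rootRep_nonneg_of_mem_boxSet (hθ : IsHighestRoot b θ) {x : AffineWeylGroup b θ}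
    (hx : x ∈ boxSet b θ) {β : Option b.support → ℤ} (h : IsAffineRoot b θ β) (h0 : 0 ≤ β)
    (hpos : 0 < finHeight b θ β) : 0 ≤ rootRep b θ x β := by
  rw [rootRep_eq_sum_finCoeff]
  exact add_nonneg (Finset.sum_nonneg fun j _ => smul_nonneg (h.finCoeff_nonneg hpos j) (hx j).1)
    (smul_nonneg (h0 none) (deltaInt_nonneg hθ))

theorem affineRep_rho_apply [P.IsRootSystem] (x : AffineWeylGroup b θ) (i : Option b.support) :
    affineRep b θ x (rho b θ none) i = finHeight b θ (rootRep b θ x⁻¹ (Pi.single i 1)) := by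
  rw [affineRep_apply, latticePairing_rho_none]

/-! ### Firing moves and the box -/

theorem rootRep_inv_eq_of_eq {x : AffineWeylGroup b θ} {β γ : Option b.support → ℤ}
    (h : rootRep b θ x β = γ) : rootRep b θ x⁻¹ γ = β := by
  rw [← h, rootRep_inv_apply_self]

/-- The bounds can only fail when `xα_j = α_i` or `xα_j = δ - α_i`, where the amplitude of `i` is
`1` or `-1`. This is where the threshold `-1` comes from. -/
theorem simple_mul_mem_boxSet [P.IsReduced] (hθ : IsHighestRoot b θ)
    {x : AffineWeylGroup b θ} (hx : x ∈ boxSet b θ) {i : Option b.support}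
    (hi : finHeight b θ (rootRep b θ x⁻¹ (Pi.single i 1)) < -1) :
    (affineSystem b θ).simple i * x ∈ boxSet b θ ∧
      (affineSystem b θ).length ((affineSystem b θ).simple i * x) =
        (affineSystem b θ).length x + 1 := by
  constructor
  · intro j
    have hr := isAffineRoot_rootRep_single x (some j)
    rw [rootRep_mul_apply, rootRep_simple]
    constructor
    · refine ((hr.rootRefl i).nonneg_or_nonpos hθ).resolve_right fun hneg => ?_
      have := rootRep_inv_eq_of_eq (eq_single_of_rootRefl_nonpos hr (hx j).1 hneg)
      rw [this, finHeight_single] at hi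
      omega
    · have e : deltaInt b θ - rootRefl (extCartan b θ) i (rootRep b θ x (Pi.single (some j) 1)) =
          rootRefl (extCartan b θ) i
            (deltaInt b θ - rootRep b θ x (Pi.single (some j) 1)) := by
        rw [map_sub, rootRefl_deltaInt]
      rw [← sub_nonneg, e]
      refine ((hr.deltaInt_sub.rootRefl i).nonneg_or_nonpos hθ).resolve_right fun hneg => ?_
      have h1 := eq_single_of_rootRefl_nonpos hr.deltaInt_sub (sub_nonneg.2 (hx j).2) hneg
      rw [← h1, map_sub, rootRep_deltaInt, rootRep_inv_apply_self, map_sub, finHeight_deltaInt,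
        finHeight_single] at hi
      omega
  · rw [length_simple_mul_eq_iff hθ]
    have hr := isAffineRoot_rootRep_single x⁻¹ i
    -- Otherwise `-x⁻¹α_i` is a nonnegative root of positive height, which `x` keeps nonnegative;
    -- but its image is `-α_i`.
    refine (hr.nonneg_or_nonpos hθ).resolve_right fun hneg => ?_
    have h1 := rootRep_nonneg_of_mem_boxSet hθ hx hr.neg (neg_nonneg.2 hneg)
      (by rw [map_neg]; omega)
    rw [map_neg, rootRep_apply_inv_self] at h1
    simpa using h1 i

theorem mem_boxSet_of_simple_mul_mem [P.IsReduced] (hθ : IsHighestRoot b θ)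
    {x : AffineWeylGroup b θ} {i : Option b.support}
    (hx : (affineSystem b θ).simple i * x ∈ boxSet b θ)
    (hl : (affineSystem b θ).length ((affineSystem b θ).simple i * x) =
        (affineSystem b θ).length x + 1) :
    x ∈ boxSet b θ ∧ finHeight b θ (rootRep b θ x⁻¹ (Pi.single i 1)) < -1 := by
  rw [length_simple_mul_eq_iff hθ] at hl
  set y := (affineSystem b θ).simple i * x with hy
  have hxy : x = (affineSystem b θ).simple i * y := by
    rw [hy, (affineSystem b θ).simple_mul_simple_cancel_left]
  have hr := isAffineRoot_rootRep_single x⁻¹ i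
  have hyi : rootRep b θ y⁻¹ (Pi.single i 1) = -rootRep b θ x⁻¹ (Pi.single i 1) :=
    rootRep_inv_simple_mul_single x i
  have hyx : rootRep b θ y (rootRep b θ x⁻¹ (Pi.single i 1)) = -Pi.single i 1 := by
    rw [← neg_neg (rootRep b θ x⁻¹ (Pi.single i 1)), ← hyi, map_neg, rootRep_apply_inv_self]
  constructor
  · intro j
    have hry := isAffineRoot_rootRep_single y (some j)
    rw [hxy, rootRep_mul_apply, rootRep_simple]
    constructor
    · refine ((hry.rootRefl i).nonneg_or_nonpos hθ).resolve_right fun hneg => ?_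
      have := rootRep_inv_eq_of_eq (eq_single_of_rootRefl_nonpos hry (hx j).1 hneg)
      -- Here `yα_j = α_i` would give `x⁻¹α_i = -α_j`, against `hl`; in the other case `yα_j = δ -
      -- α_i` gives `x⁻¹α_i = α_j - δ`.
      rw [hyi] at this
      have h2 := hl (some j)
      rw [← neg_neg (rootRep b θ x⁻¹ (Pi.single i 1)), this] at h2
      simp at h2
    · have e : deltaInt b θ - rootRefl (extCartan b θ) i (rootRep b θ y (Pi.single (some j) 1)) =
          rootRefl (extCartan b θ) i
            (deltaInt b θ - rootRep b θ y (Pi.single (some j) 1)) := by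
        rw [map_sub, rootRefl_deltaInt]
      rw [← sub_nonneg, e]
      refine ((hry.deltaInt_sub.rootRefl i).nonneg_or_nonpos hθ).resolve_right fun hneg => ?_
      have h1 := eq_single_of_rootRefl_nonpos hry.deltaInt_sub (sub_nonneg.2 (hx j).2) hneg
      rw [← h1, map_sub, rootRep_deltaInt, rootRep_inv_apply_self] at hyi
      have h2 := hl none
      rw [← neg_neg (rootRep b θ x⁻¹ (Pi.single i 1)), ← h1, ← hyi] at h2
      simp [deltaInt_none] at h2
  · by_contra! hge
    have hne := hr.finHeight_ne_zero
    by_cases hpos : 0 < finHeight b θ (rootRep b θ x⁻¹ (Pi.single i 1))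
    · have h1 := rootRep_nonneg_of_mem_boxSet hθ hx hr hl hpos i
      rw [hyx] at h1
      simp at h1
    -- Height exactly `-1`: now `x⁻¹α_i = -α_j + kδ`, with `k ≥ 1` by nonnegativity. Then `yα_j =
    -- α_i + kδ` exceeds `δ` at `i`.
    · obtain ⟨j, hj⟩ := hr.neg.eq_single_add_of_finHeight_eq_one (by rw [map_neg]; omega)
      rw [neg_eq_iff_eq_neg] at hj
      have h0 : 0 ≤ rootRep b θ x⁻¹ (Pi.single i 1) none := hl none
      have hk : 1 ≤ rootRep b θ x⁻¹ (Pi.single i 1) none := by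
        rcases h0.lt_or_eq with h | h
        · exact h
        · have h2 := hl (some j)
          have h3 := congrFun hj (some j)
          rw [Pi.neg_apply, Pi.add_apply, Pi.smul_apply, Pi.neg_apply, ← h] at h3
          rw [h3] at h2
          simp at h2
      rw [hj, map_neg, map_add, map_smul, rootRep_deltaInt] at hyx
      have h3 := (hx j).2 i
      have h4 := congrFun hyx i
      have h5 := one_le_deltaInt hθ i
      simp only [Pi.neg_apply, Pi.add_apply, Pi.smul_apply, smul_eq_mul, Pi.single_eq_same] at h4
      nlinarith

end Box

section Dynamics

open Classical

variable {ι M N : Type*} [AddCommGroup M] [Module ℝ M] [AddCommGroup N] [Module ℝ N]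
  {P : RootPairing ι ℝ M N} {b : P.Base} {θ : ι} [P.IsCrystallographic]

/-! ### Firing sequences and the left weak order -/

variable (b θ) in
/-- The element `s_{i_m} ⋯ s_{i_1}` attached to a firing sequence `i_1, …, i_m`. -/
noncomputable def firingProd (ω : List (Option b.support)) : AffineWeylGroup b θ :=
  (ω.map (affineSystem b θ).simple).reverse.prod

theorem firingProd_nil : firingProd b θ [] = 1 := rfl

theorem firingProd_cons (i : Option b.support) (ω : List (Option b.support)) :
    firingProd b θ (i :: ω) = firingProd b θ ω * (affineSystem b θ).simple i := by
  simp [firingProd]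

theorem firingProd_reverse (ω : List (Option b.support)) :
    firingProd b θ ω.reverse = (affineSystem b θ).wordProd ω := by
  simp [firingProd, CoxeterSystem.wordProd]

theorem length_firingProd_le (ω : List (Option b.support)) :
    (affineSystem b θ).length (firingProd b θ ω) ≤ ω.length := by
  rw [← ω.reverse_reverse, firingProd_reverse]
  exact ((affineSystem b θ).length_wordProd_le _).trans (by simp)

theorem fire_affineRep (i : Option b.support) (x : AffineWeylGroup b θ)
    (v : Option b.support → ℝ) :
    fire (extCartan b θ) i (affineRep b θ x v) =
      affineRep b θ ((affineSystem b θ).simple i * x) v := by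
  rw [map_mul, LinearEquiv.mul_apply, affineRep_simple]

theorem affineRep_rho_lt_iff [P.IsRootSystem] (x : AffineWeylGroup b θ) (i : Option b.support) :
    affineRep b θ x (rho b θ none) i < -1 ↔
      finHeight b θ (rootRep b θ x⁻¹ (Pi.single i 1)) < -1 := by
  rw [affineRep_rho_apply]
  exact_mod_cast Iff.rfl

theorem StrictFiring.mem_boxSet [P.IsRootSystem] [P.IsReduced] (hθ : IsHighestRoot b θ)
    {ω : List (Option b.support)} {x : AffineWeylGroup b θ} (hx : x ∈ boxSet b θ)
    {v : Option b.support → ℝ}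
    (h : StrictFiring (extCartan b θ) ω (affineRep b θ x (rho b θ none)) v) :
    firingProd b θ ω * x ∈ boxSet b θ ∧
      affineRep b θ (firingProd b θ ω * x) (rho b θ none) = v ∧
      (affineSystem b θ).length (firingProd b θ ω * x) =
        (affineSystem b θ).length x + ω.length := by
  induction ω generalizing x with
  | nil =>
    cases h
    simpa [firingProd_nil] using hx
  | cons i ω ih =>
    cases h with
    | cons hi h =>
      rw [fire_affineRep] at h
      obtain ⟨h1, h2⟩ := simple_mul_mem_boxSet hθ hx ((affineRep_rho_lt_iff x i).1 hi)
      obtain ⟨h3, h4, h5⟩ := ih h1 h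
      rw [firingProd_cons, mul_assoc]
      refine ⟨h3, h4, ?_⟩
      rw [h5, h2, List.length_cons]
      omega

/-- Additivity of length forces each letter to lengthen by one, so box membership is pulled back
from the end of the word to its start. -/
theorem strictFiring_of_length_eq [P.IsRootSystem] [P.IsReduced] (hθ : IsHighestRoot b θ)
    {ω : List (Option b.support)} {x : AffineWeylGroup b θ}
    (hx : firingProd b θ ω * x ∈ boxSet b θ)
    (hl : (affineSystem b θ).length (firingProd b θ ω * x) =
        (affineSystem b θ).length x + ω.length) :
    x ∈ boxSet b θ ∧ StrictFiring (extCartan b θ) ω (affineRep b θ x (rho b θ none))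
      (affineRep b θ (firingProd b θ ω * x) (rho b θ none)) := by
  induction ω generalizing x with
  | nil => exact ⟨by simpa [firingProd_nil] using hx, by
      rw [firingProd_nil, one_mul]; exact StrictFiring.nil _⟩
  | cons i ω ih =>
    rw [firingProd_cons, mul_assoc] at hx hl ⊢
    have h1 := (affineSystem b θ).length_mul_le (firingProd b θ ω)
      ((affineSystem b θ).simple i * x)
    have h2 := length_firingProd_le (θ := θ) ω
    have h3 := (affineSystem b θ).length_simple_mul x i
    rw [List.length_cons] at hl
    have h4 : (affineSystem b θ).length ((affineSystem b θ).simple i * x) =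
        (affineSystem b θ).length x + 1 := by omega
    obtain ⟨h5, h6⟩ := ih hx (by omega)
    obtain ⟨h7, h8⟩ := mem_boxSet_of_simple_mul_mem hθ h5 h4
    exact ⟨h7, StrictFiring.cons ((affineRep_rho_lt_iff x i).2 h8)
      (by rw [fire_affineRep]; exact h6)⟩

theorem exists_strictFiring_of_leftWeakLE [P.IsRootSystem] [P.IsReduced] (hθ : IsHighestRoot b θ)
    {x y : AffineWeylGroup b θ} (hy : y ∈ boxSet b θ) (h : LeftWeakLE (affineSystem b θ) x y) :
    x ∈ boxSet b θ ∧ StrictlyObtainable (extCartan b θ) (affineRep b θ x (rho b θ none))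
      (affineRep b θ y (rho b θ none)) := by
  obtain ⟨ω, hω, e⟩ := (affineSystem b θ).exists_isReduced (y * x⁻¹)
  have e' : firingProd b θ ω.reverse * x = y := by
    rw [firingProd_reverse, ← e, inv_mul_cancel_right]
  have := strictFiring_of_length_eq hθ (ω := ω.reverse) (x := x) (by rwa [e']) (by
    rw [e', List.length_reverse, ← hω.eq, ← e]; exact h)
  rw [e'] at this
  exact ⟨this.1, _, this.2⟩

theorem leftWeakLE_firingProd_mul {ω : List (Option b.support)} {x : AffineWeylGroup b θ}
    (hl : (affineSystem b θ).length (firingProd b θ ω * x) =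
        (affineSystem b θ).length x + ω.length) :
    LeftWeakLE (affineSystem b θ) x (firingProd b θ ω * x) := by
  have h1 := (affineSystem b θ).length_mul_le (firingProd b θ ω) x
  have h2 := length_firingProd_le (θ := θ) ω
  rw [LeftWeakLE, mul_inv_cancel_right]
  omega

theorem leftWeakLE_one (x : AffineWeylGroup b θ) : LeftWeakLE (affineSystem b θ) 1 x := by
  simp [LeftWeakLE]

/-! ### The finite Weyl group -/

theorem finPart_rootRep_simple (i : Option b.support) (β : Option b.support → ℤ) :
    finPart b θ (rootRep b θ ((affineSystem b θ).simple i) β) =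
      P.reflection (extRoot b θ i) (finPart b θ β) := by
  rw [rootRep_simple, finPart_rootRefl]

theorem exists_mem_finiteWeyl_reflection [Finite ι] [P.IsReduced] (k : ι) :
    ∃ w ∈ finiteWeyl b θ, ∀ β, finPart b θ (rootRep b θ w β) = P.reflection k (finPart b θ β) := by
  have hs : ∀ i ∈ b.support, ∃ w ∈ finiteWeyl b θ,
      ∀ β, finPart b θ (rootRep b θ w β) = P.reflection i (finPart b θ β) := fun i hi =>
    ⟨_, Subgroup.subset_closure ⟨⟨i, hi⟩, rfl⟩, finPart_rootRep_simple (some ⟨i, hi⟩)⟩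
  refine b.induction_reflect k (p := fun k => ∃ w ∈ finiteWeyl b θ,
    ∀ β, finPart b θ (rootRep b θ w β) = P.reflection k (finPart b θ β)) ?_ hs ?_
  · rintro i ⟨w, hw, h⟩
    refine ⟨w, hw, fun β => ?_⟩
    rw [h, P.reflection_reflectionPerm, mul_assoc, LinearEquiv.mul_apply, LinearEquiv.mul_apply,
      P.reflection_same]
  · rintro i j ⟨w, hw, h⟩ hj
    obtain ⟨u, hu, h'⟩ := hs j hj
    refine ⟨u * w * u, mul_mem (mul_mem hu hw) hu, fun β => ?_⟩
    rw [P.reflection_reflectionPerm, LinearEquiv.mul_apply, LinearEquiv.mul_apply,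
      rootRep_mul_apply, rootRep_mul_apply, h', h, h']

/-- On finite parts `s_{i₀}` acts as the reflection in `θ`, which `W₀` already contains. -/
theorem exists_mem_finiteWeyl_finPart [Finite ι] [P.IsReduced] (x : AffineWeylGroup b θ) :
    ∃ w ∈ finiteWeyl b θ, ∀ β, finPart b θ (rootRep b θ w β) = finPart b θ (rootRep b θ x β) := by
  induction x using (affineSystem b θ).simple_induction_left with
  | one => exact ⟨1, one_mem _, fun _ => rfl⟩
  | mul_simple_left x i ih =>
    obtain ⟨w, hw, h⟩ := ih
    obtain ⟨u, hu, h'⟩ := exists_mem_finiteWeyl_reflection (b := b) (θ := θ) (extRoot b θ i)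
    refine ⟨u * w, mul_mem hu hw, fun β => ?_⟩
    rw [rootRep_mul_apply, rootRep_mul_apply, h', h, finPart_rootRep_simple]

theorem rootRep_apply_none_of_mem_finiteWeyl {w : AffineWeylGroup b θ} (hw : w ∈ finiteWeyl b θ)
    (β : Option b.support → ℤ) : rootRep b θ w β none = β none := by
  have h (j : b.support) (β : Option b.support → ℤ) :
      rootRep b θ ((affineSystem b θ).simple (some j)) β none = β none := by
    rw [rootRep_simple, rootRefl_apply]
    simp
  induction hw using Subgroup.closure_induction generalizing β with
  | mem x hx =>
    obtain ⟨j, rfl⟩ := hx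
    exact h j β
  | one => simp
  | mul x y _ _ hx hy => rw [rootRep_mul_apply, hx, hy]
  | inv x _ hx => rw [← hx (rootRep b θ x⁻¹ β), rootRep_apply_inv_self]

/-! ### Elements with the same image of `ρ` -/

omit [P.IsCrystallographic] in
theorem finHeight_eq_of_finPart_eq {β γ : Option b.support → ℤ}
    (h : finPart b θ β = finPart b θ γ) : finHeight b θ β = finHeight b θ γ := by
  have := eq_smul_deltaInt_of_finPart_eq_zero (b := b) (θ := θ) (β := β - γ) (by simp [h])
  rw [← sub_eq_zero, ← map_sub, this, map_smul, finHeight_deltaInt, smul_zero]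

/-- Fixing `ρ` preserves heights, and `W₀` preserves the coefficient at `i₀`; so all simple affine
roots stay positive. -/
theorem eq_one_of_mem_finiteWeyl [P.IsRootSystem] (hθ : IsHighestRoot b θ)
    {w : AffineWeylGroup b θ} (hw : w ∈ finiteWeyl b θ)
    (h : affineRep b θ w (rho b θ none) = rho b θ none) : w = 1 := by
  refine eq_one_of_rootRep_nonneg hθ fun i => ?_
  have hr := isAffineRoot_rootRep_single w i
  have hn := rootRep_apply_none_of_mem_finiteWeyl hw (Pi.single i 1)
  cases i with
  | none => exact hr.nonneg_of_pos hθ (i := none) (by simp [hn])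
  | some i =>
    have h1 : finHeight b θ (rootRep b θ w (Pi.single (some i) 1)) = 1 := by
      have := latticePairing_rootRep w (Pi.single (some i) 1) (rho b θ none)
      rw [h, latticePairing_rho_none, latticePairing_rho_none, finHeight_single] at this
      exact_mod_cast this
    intro j
    cases j with
    | none => simp [hn]
    | some j =>
      have := hr.finCoeff_nonneg (by omega) j
      simpa [finCoeff, hn] using this

/-- An element of the affine Weyl group that fixes `ρ` is a translation. -/
theorem finPart_rootRep_of_fixes [Finite ι] [P.IsReduced] [P.IsRootSystem] (hθ : IsHighestRoot b θ)
    {z : AffineWeylGroup b θ} (h : affineRep b θ z (rho b θ none) = rho b θ none)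
    (β : Option b.support → ℤ) : finPart b θ (rootRep b θ z⁻¹ β) = finPart b θ β := by
  obtain ⟨w, hw, hwz⟩ := exists_mem_finiteWeyl_finPart z⁻¹
  have : w⁻¹ = 1 := by
    refine eq_one_of_mem_finiteWeyl hθ (inv_mem hw) (funext fun i => ?_)
    rw [affineRep_rho_apply, inv_inv, finHeight_eq_of_finPart_eq (hwz _), ← affineRep_rho_apply, h]
  rw [← hwz, inv_eq_one.1 this, map_one, Module.End.one_apply]

theorem exists_mem_finiteWeyl_affineRep [Finite ι] [P.IsReduced] [P.IsRootSystem] (x : AffineWeylGroup b θ) :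
    ∃ w ∈ finiteWeyl b θ, affineRep b θ w (rho b θ none) = affineRep b θ x (rho b θ none) := by
  obtain ⟨w, hw, hwx⟩ := exists_mem_finiteWeyl_finPart x⁻¹
  refine ⟨w⁻¹, inv_mem hw, funext fun i => ?_⟩
  rw [affineRep_rho_apply, affineRep_rho_apply, inv_inv, finHeight_eq_of_finPart_eq (hwx _)]

theorem eq_of_mem_finiteWeyl_of_affineRep_eq [P.IsRootSystem] (hθ : IsHighestRoot b θ)
    {w w' : AffineWeylGroup b θ} (hw : w ∈ finiteWeyl b θ) (hw' : w' ∈ finiteWeyl b θ)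
    (h : affineRep b θ w (rho b θ none) = affineRep b θ w' (rho b θ none)) : w = w' := by
  have := eq_one_of_mem_finiteWeyl hθ (mul_mem (inv_mem hw') hw) (by
    rw [map_mul, LinearEquiv.mul_apply, h, ← LinearEquiv.mul_apply, ← map_mul, inv_mul_cancel,
      map_one]; rfl)
  exact (inv_mul_eq_one.1 this).symm

theorem eq_of_mem_boxSet_of_affineRep_eq [Finite ι] [P.IsReduced] [P.IsRootSystem] (hθ : IsHighestRoot b θ)
    {x y : AffineWeylGroup b θ} (hx : x ∈ boxSet b θ) (hy : y ∈ boxSet b θ)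
    (h : affineRep b θ x (rho b θ none) = affineRep b θ y (rho b θ none)) : x = y := by
  have hfix : affineRep b θ (x⁻¹ * y) (rho b θ none) = rho b θ none := by
    rw [map_mul, LinearEquiv.mul_apply, ← h, ← LinearEquiv.mul_apply, ← map_mul, inv_mul_cancel,
      map_one]; rfl
  have hz := finPart_rootRep_of_fixes hθ hfix
  have key : ∀ j : b.support, rootRep b θ (x⁻¹ * y)⁻¹ (Pi.single (some j) 1) =
      Pi.single (some j) 1 := by
    intro j
    have h1 := eq_smul_deltaInt_of_finPart_eq_zero (b := b) (θ := θ)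
      (β := rootRep b θ (x⁻¹ * y)⁻¹ (Pi.single (some j) 1) - Pi.single (some j) 1)
      (by rw [map_sub, hz, sub_self])
    set m := (rootRep b θ (x⁻¹ * y)⁻¹ (Pi.single (some j) 1) - Pi.single (some j) 1 :
      Option b.support → ℤ) none
    have h2 : rootRep b θ x (Pi.single (some j) 1) =
        rootRep b θ y (Pi.single (some j) 1) + m • deltaInt b θ := by
      have := congrArg (rootRep b θ y) h1
      rw [map_sub, map_smul, rootRep_deltaInt, mul_inv_rev, inv_inv, rootRep_mul_apply,
        rootRep_apply_inv_self, sub_eq_iff_eq_add'] at this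
      exact this
    -- Both `xα_j` and `yα_j` lie in `[0, δ]` and differ by `mδ`; if `m ≠ 0`, one of them would also
    -- be nonpositive.
    have hm : m = 0 := by
      rcases lt_trichotomy m 0 with hm | hm | hm
      · exfalso
        refine (isAffineRoot_rootRep_single x (some j)).not_nonneg_and_nonpos (hx j).1 fun l => ?_
        have e := congrFun h2 l
        have e1 := (hy j).2 l
        have e2 := one_le_deltaInt hθ l
        simp only [Pi.add_apply, Pi.smul_apply, smul_eq_mul] at e
        simp only [Pi.zero_apply]
        nlinarith
      · exact hm
      · exfalso
        refine (isAffineRoot_rootRep_single y (some j)).not_nonneg_and_nonpos (hy j).1 fun l => ?_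
        have e := congrFun h2 l
        have e1 := (hx j).2 l
        have e2 := one_le_deltaInt hθ l
        simp only [Pi.add_apply, Pi.smul_apply, smul_eq_mul] at e
        simp only [Pi.zero_apply]
        nlinarith
    rw [hm, zero_smul, sub_eq_zero] at h1
    exact h1
  have : (x⁻¹ * y)⁻¹ = 1 := by
    refine eq_one_of_rootRep_nonneg hθ fun i => ?_
    rw [rootRep_eq_sum_finCoeff]
    simp_rw [key]
    rw [← eq_sum_finCoeff]
    simp
  exact inv_mul_eq_one.1 (inv_eq_one.1 this)

end Dynamics

/-! ### The top element -/

section Top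

open Classical

variable {ι M N : Type*} [AddCommGroup M] [Module ℝ M] [AddCommGroup N] [Module ℝ N]
  {P : RootPairing ι ℝ M N} {b : P.Base} {θ : ι} [P.IsCrystallographic]

/-- `x` maps each simple finite root `α_k` to `δ - α_{j k}`, where `j k ≠ i`. -/
def IsTopForm (x : AffineWeylGroup b θ) (i : Option b.support)
    (j : b.support → Option b.support) : Prop :=
  ∀ k, j k ≠ i ∧ rootRep b θ x (Pi.single (some k) 1) = deltaInt b θ - Pi.single (j k) 1

theorem IsTopForm.rootRep_eq {x : AffineWeylGroup b θ} {i : Option b.support}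
    {j : b.support → Option b.support} (h : IsTopForm x i j) (β : Option b.support → ℤ) :
    rootRep b θ x β = (finHeight b θ β + β none) • deltaInt b θ -
      ∑ k, finCoeff b θ β k • Pi.single (j k) 1 := by
  rw [rootRep_eq_sum_finCoeff, finHeight_apply, add_smul, Finset.sum_smul,
    add_sub_right_comm, ← Finset.sum_sub_distrib]
  congr 1
  exact Finset.sum_congr rfl fun k _ => by rw [(h k).2, smul_sub]

theorem IsTopForm.rootRep_apply {x : AffineWeylGroup b θ} {i : Option b.support}
    {j : b.support → Option b.support} (h : IsTopForm x i j) (β : Option b.support → ℤ) :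
    rootRep b θ x β i = (finHeight b θ β + β none) * deltaInt b θ i := by
  rw [h.rootRep_eq, Pi.sub_apply, Finset.sum_apply, Finset.sum_eq_zero, sub_zero, Pi.smul_apply,
    smul_eq_mul]
  intro k _
  simp [(h k).1.symm]

/-- Every value of `x` has `i`-coordinate divisible by `δ_i`, and `α_i` is such a value. -/
theorem IsTopForm.deltaInt_eq_one (hθ : IsHighestRoot b θ) {x : AffineWeylGroup b θ}
    {i : Option b.support} {j : b.support → Option b.support} (h : IsTopForm x i j) :
    deltaInt b θ i = 1 := by
  have h1 := h.rootRep_apply (rootRep b θ x⁻¹ (Pi.single i 1))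
  rw [rootRep_apply_inv_self, Pi.single_eq_same] at h1
  exact Int.eq_one_of_dvd_one (deltaInt_nonneg hθ i) (Dvd.intro_left _ h1.symm)

/-- The sign of `xβ` is that of `finHeight β + β none`, and if this vanishes it is opposite to the
sign of the finite part of `β`. Neither depends on `x`, `i` or `j`. -/
theorem IsTopForm.rootRep_nonneg (hθ : IsHighestRoot b θ) {x x' : AffineWeylGroup b θ}
    {i i' : Option b.support} {j j' : b.support → Option b.support} (h : IsTopForm x i j)
    (h' : IsTopForm x' i' j') {β : Option b.support → ℤ} (hβ : IsAffineRoot b θ β)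
    (h0 : 0 ≤ rootRep b θ x β) : 0 ≤ rootRep b θ x' β := by
  have h1 : 0 ≤ rootRep b θ x β i := h0 i
  rw [h.rootRep_apply] at h1
  have h2 := one_le_deltaInt hθ i
  have hs : 0 ≤ finHeight b θ β + β none := nonneg_of_mul_nonneg_left h1 (by omega)
  rcases hs.lt_or_eq with hs | hs
  · refine (hβ.rootRep x').nonneg_of_pos hθ (i := i') ?_
    rw [h'.rootRep_apply]
    exact mul_pos hs (one_le_deltaInt hθ i')
  · have hsingle (l : Option b.support) : (0 : Option b.support → ℤ) ≤ Pi.single l 1 := by simp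
    have hneg : ∀ k, finCoeff b θ β k ≤ 0 := by
      refine hβ.finCoeff_nonneg_or_nonpos.resolve_left fun hn => ?_
      refine (hβ.rootRep x).not_nonneg_and_nonpos h0 ?_
      rw [h.rootRep_eq, ← hs, zero_smul, zero_sub, neg_nonpos]
      exact Finset.sum_nonneg fun k _ => smul_nonneg (hn k) (hsingle _)
    rw [h'.rootRep_eq, ← hs, zero_smul, zero_sub, ← Finset.sum_neg_distrib]
    refine Finset.sum_nonneg fun k _ => ?_
    rw [← neg_smul]
    exact smul_nonneg (neg_nonneg.2 (hneg k)) (hsingle _)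

theorem IsTopForm.eq (hθ : IsHighestRoot b θ) {x x' : AffineWeylGroup b θ}
    {i i' : Option b.support} {j j' : b.support → Option b.support} (h : IsTopForm x i j)
    (h' : IsTopForm x' i' j') : x = x' := by
  have : x' * x⁻¹ = 1 := by
    refine eq_one_of_rootRep_nonneg hθ fun l => ?_
    rw [rootRep_mul_apply]
    refine h.rootRep_nonneg hθ h' (isAffineRoot_rootRep_single x⁻¹ l) ?_
    rw [rootRep_apply_inv_self]
    simp
  exact (mul_inv_eq_one.1 this).symm

/-- At an element where no vertex has amplitude `< -1`, all amplitudes but one are `-1`. -/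
theorem exists_forall_finHeight_eq_neg_one (hθ : IsHighestRoot b θ) {x : AffineWeylGroup b θ}
    (hmax : ∀ i, -1 ≤ finHeight b θ (rootRep b θ x⁻¹ (Pi.single i 1))) :
    ∃ i, ∀ j, j ≠ i → finHeight b θ (rootRep b θ x⁻¹ (Pi.single j 1)) = -1 := by
  set B : Option b.support → Option b.support → ℤ := fun j => rootRep b θ x⁻¹ (Pi.single j 1)
    with hB
  have hroot (j) : IsAffineRoot b θ (B j) := isAffineRoot_rootRep_single x⁻¹ j
  have hsum : ∑ j, deltaInt b θ j • B j = deltaInt b θ := by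
    conv_rhs => rw [← rootRep_deltaInt x⁻¹, pi_eq_sum_univ' (deltaInt b θ), map_sum]
    refine Finset.sum_congr rfl fun j _ => ?_
    rw [map_smul]
  -- The heights are nonzero and their sum with the positive weights `δ_j` is zero.
  have hpos : ∃ i, 0 < finHeight b θ (B i) := by
    by_contra! hneg
    have h1 := congrArg (finHeight b θ) hsum
    rw [finHeight_deltaInt, map_sum] at h1
    have h2 : ∑ j, finHeight b θ (deltaInt b θ j • B j) < 0 := by
      refine Finset.sum_neg (fun j _ => ?_) ⟨none, Finset.mem_univ _⟩
      rw [map_smul, smul_eq_mul]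
      have := lt_of_le_of_ne (hneg j) (hroot j).finHeight_ne_zero
      have := one_le_deltaInt hθ j
      nlinarith
    omega
  obtain ⟨i, hi⟩ := hpos
  refine ⟨i, fun j hji => ?_⟩
  by_contra hj
  have hj : 0 < finHeight b θ (B j) := by
    have h1 := hmax j
    have h2 := (hroot j).finHeight_ne_zero
    change finHeight b θ (B j) ≠ -1 at hj
    change -1 ≤ finHeight b θ (B j) at h1
    omega
  -- each simple root occurring in `B j` is, modulo `δ`, mapped by `x` to some `-α_l`, `l ≠ i, j`
  have key : ∀ k : b.support, ∃ m : ℤ, ∀ l, (l = i ∨ l = j) →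
      finCoeff b θ (B j) k * rootRep b θ x (Pi.single (some k) 1) l = m * deltaInt b θ l := by
    intro k
    by_cases hk : ∃ l, finHeight b θ (B l) = -1 ∧
        ∃ m : ℤ, B l = -Pi.single (some k) 1 + m • deltaInt b θ
    · obtain ⟨l, hl, m, hm⟩ := hk
      have h1 : Pi.single (some k) 1 = m • deltaInt b θ - B l := by rw [hm]; abel
      refine ⟨finCoeff b θ (B j) k * m, fun l' hl' => ?_⟩
      have hne : l' ≠ l := by
        rintro rfl
        rcases hl' with rfl | rfl <;> omega
      rw [h1, map_sub, map_smul, rootRep_deltaInt, hB, rootRep_apply_inv_self]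
      simp [hne, mul_assoc]
    -- If no `B l` is `-α_k` modulo `δ`, every `B l` has nonnegative coefficient at `k`. Their
    -- `δ`-weighted sum vanishes, so `α_k` does not occur in `B j`.
    · push Not at hk
      refine ⟨0, fun l _ => ?_⟩
      have h1 : ∑ l, deltaInt b θ l * finCoeff b θ (B l) k = 0 := by
        rw [← finCoeff_sum_smul, hsum, finCoeff_deltaInt]
      have h2 : ∀ l ∈ Finset.univ, 0 ≤ deltaInt b θ l * finCoeff b θ (B l) k := by
        intro l _
        refine mul_nonneg (deltaInt_nonneg hθ l) ?_
        by_cases hl : 0 < finHeight b θ (B l)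
        · exact (hroot l).finCoeff_nonneg hl k
        · have h3 : finHeight b θ (B l) = -1 := by
            have h3 := hmax l
            have h4 := (hroot l).finHeight_ne_zero
            change -1 ≤ finHeight b θ (B l) at h3
            omega
          obtain ⟨k', hk'⟩ := (hroot l).neg.eq_single_add_of_finHeight_eq_one
            (by rw [map_neg, h3, neg_neg])
          have hkk : k ≠ k' := by
            rintro rfl
            refine hk l h3 (B l none) ?_
            rw [← neg_neg (B l), hk']
            simp only [Pi.neg_apply, Pi.add_apply, Pi.smul_apply, deltaInt_none]
            ext
            simp [add_comm]
          have h5 : finCoeff b θ (-B l) k = 0 := by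
            rw [hk']
            simp [finCoeff, deltaInt_none, hkk]
          simp only [finCoeff, Pi.neg_apply] at h5 ⊢
          linarith
      have h3 := (Finset.sum_eq_zero_iff_of_nonneg h2).1 h1 j (Finset.mem_univ j)
      have h4 := one_le_deltaInt hθ j
      rw [(mul_eq_zero.1 h3).resolve_left (by omega), zero_mul, zero_mul]
  choose m hm using key
  -- Thus `α_j = x (B j)` is proportional to `δ` on the coordinates `i` and `j`; but it is `0` at
  -- `i` and `1` at `j`.
  have h1 : ∀ l, (l = i ∨ l = j) → (Pi.single j 1 : Option b.support → ℤ) l =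
      (∑ k, m k + B j none) * deltaInt b θ l := by
    intro l hl
    have := congrFun (rootRep_eq_sum_finCoeff x (B j)) l
    rw [hB, rootRep_apply_inv_self, Pi.add_apply, Finset.sum_apply] at this
    rw [this, add_mul, Finset.sum_mul]
    congr 1
    exact Finset.sum_congr rfl fun k _ => hm k l hl
  have h2 := h1 i (Or.inl rfl)
  have h3 := h1 j (Or.inr rfl)
  have h4 := one_le_deltaInt hθ i
  rw [Pi.single_eq_of_ne hji.symm] at h2
  rw [(mul_eq_zero.1 h2.symm).resolve_right (by omega), Pi.single_eq_same, zero_mul] at h3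
  exact one_ne_zero h3

theorem exists_isTopForm (hθ : IsHighestRoot b θ) {x : AffineWeylGroup b θ}
    (hx : x ∈ boxSet b θ)
    (hmax : ∀ i, -1 ≤ finHeight b θ (rootRep b θ x⁻¹ (Pi.single i 1))) :
    ∃ i j, IsTopForm x i j ∧
      ∀ l, l ≠ i → finHeight b θ (rootRep b θ x⁻¹ (Pi.single l 1)) = -1 := by
  obtain ⟨i, hi⟩ := exists_forall_finHeight_eq_neg_one hθ hmax
  have h1 : ∀ l : {l // l ≠ i}, ∃ k : b.support,
      rootRep b θ x (Pi.single (some k) 1) = deltaInt b θ - Pi.single l.1 1 := by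
    rintro ⟨l, hl⟩
    have hr := isAffineRoot_rootRep_single x⁻¹ l
    obtain ⟨k, hk⟩ := hr.neg.eq_single_add_of_finHeight_eq_one (by rw [map_neg, hi l hl, neg_neg])
    refine ⟨k, ?_⟩
    set c := (-rootRep b θ x⁻¹ (Pi.single l 1)) none
    have h2 := congrArg (rootRep b θ x) hk
    rw [map_neg, map_add, map_smul, rootRep_deltaInt, rootRep_apply_inv_self] at h2
    have h3 : rootRep b θ x (Pi.single (some k) 1) = (-c) • deltaInt b θ - Pi.single l 1 := by
      rw [sub_eq_add_neg, h2]
      module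
    have h4 : 0 ≤ rootRep b θ x (Pi.single (some k) 1) l := (hx k).1 l
    have h5 := (hx k).2 i
    have h6 := one_le_deltaInt hθ l
    have h7 := one_le_deltaInt hθ i
    rw [h3] at h4 h5
    simp only [Pi.sub_apply, Pi.smul_apply, smul_eq_mul, Pi.single_eq_same,
      Pi.single_eq_of_ne hl.symm, sub_zero] at h4 h5
    -- Coordinate `l` of `0 ≤ xα_k` gives `-c ≥ 1`; coordinate `i` of `xα_k ≤ δ` gives `-c ≤ 1`.
    have h8 : -c = 1 := by
      refine le_antisymm ?_ ?_
      · by_contra! h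
        nlinarith
      · by_contra! h
        nlinarith
    rw [h3, h8, one_smul]
  choose κ hκ using h1
  have hinj : Function.Injective κ := by
    intro l l' h
    have := hκ l
    rw [h, hκ l', sub_right_inj] at this
    by_contra hne
    have h2 := congrFun this l
    rw [Pi.single_eq_same, Pi.single_eq_of_ne fun h => hne (Subtype.ext h)] at h2
    exact zero_ne_one h2
  -- Removing one vertex from `I` leaves as many vertices as `I₀` has, so every `k` is reached.
  have hbij : Function.Bijective κ := by
    rw [Fintype.bijective_iff_injective_and_card]
    refine ⟨hinj, ?_⟩
    simp
  choose j hj using hbij.2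
  exact ⟨i, fun k => j k, fun k => ⟨(j k).2, by rw [← hκ, hj]⟩, hi⟩

theorem affineRep_rho_eq_neg_rho [P.IsRootSystem] (hθ : IsHighestRoot b θ)
    {x : AffineWeylGroup b θ} {i : Option b.support}
    (hi : ∀ l, l ≠ i → finHeight b θ (rootRep b θ x⁻¹ (Pi.single l 1)) = -1) :
    affineRep b θ x (rho b θ none) = -rho b θ i := by
  have h1 (l) (hl : l ≠ i) : affineRep b θ x (rho b θ none) l = -1 := by
    rw [affineRep_rho_apply, hi l hl]; simp
  have h2 : latticePairing (deltaInt b θ) (affineRep b θ x (rho b θ none)) = 0 := by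
    rw [← rootRep_deltaInt x, latticePairing_rootRep, latticePairing_rho_none, finHeight_deltaInt,
      Int.cast_zero]
  ext l
  by_cases hl : l = i
  · subst hl
    rw [latticePairing, ← Finset.sum_erase_add _ _ (Finset.mem_univ l),
      Finset.sum_congr rfl fun k hk => by rw [h1 k (Finset.ne_of_mem_erase hk), mul_neg_one],
      Finset.sum_neg_distrib] at h2
    have h3 : (deltaInt b θ l : ℝ) ≠ 0 := by
      have := one_le_deltaInt hθ l
      exact_mod_cast (by omega : deltaInt b θ l ≠ 0)
    simp only [Pi.neg_apply, rho, if_true, delta_eq_deltaInt]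
    field_simp
    linarith
  · simp [h1 l hl, rho, hl]

/-! ### A vertex with `δ_i = 1` is extending -/

omit [P.IsCrystallographic] in
theorem linearIndepOn_extRoot_ne (hθ : IsHighestRoot b θ) (i : Option b.support) :
    LinearIndepOn ℝ (P.root ∘ extRoot b θ) {j | j ≠ i} := by
  rw [linearIndepOn_iff'']
  intro s g hs hg h
  have hgi : g i = 0 := hg i fun hi => hs hi rfl
  have h1 : ∑ j, g j • P.root (extRoot b θ j) = 0 := by
    rw [← h]
    exact (Finset.sum_subset (Finset.subset_univ s) fun j _ hj => by simp [hg j hj]).symm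
  have h2 : ∑ k : b.support, (g (some k) - g none * deltaInt b θ (some k)) • P.root k = 0 := by
    rw [← h1, Fintype.sum_option]
    simp only [extRoot, P.root_reflectionPerm, P.reflection_apply_self]
    rw [root_eq_sum_deltaInt b θ, ← Finset.sum_neg_distrib, Finset.smul_sum,
      ← Finset.sum_add_distrib]
    refine Finset.sum_congr rfl fun k _ => ?_
    rw [← Int.cast_smul_eq_zsmul ℝ]
    module
  have h3 := Fintype.linearIndependent_iff.1 b.linearIndepOn_root _ h2
  -- Every linear relation among the extended simple roots is a multiple of `δ`, which has no zero
  -- coordinate.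
  have h4 : ∀ l, g l = g none * deltaInt b θ l := by
    intro l
    cases l with
    | none => simp [deltaInt_none]
    | some k => linarith [h3 k]
  have h5 : (deltaInt b θ i : ℝ) ≠ 0 := by
    have := one_le_deltaInt hθ i
    exact_mod_cast (by omega : deltaInt b θ i ≠ 0)
  have h6 : g none = 0 := by
    have := h4 i
    rw [hgi] at this
    exact (mul_eq_zero.1 this.symm).resolve_right h5
  intro l _
  rw [h4, h6, zero_mul]

omit [P.IsCrystallographic] in
theorem exists_finPart_eq_root_of_deltaInt_eq_one {i : Option b.support}
    (hi : deltaInt b θ i = 1) (k : ι) (c : ℤ) :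
    ∃ β, finPart b θ β = P.root k ∧ β i = c := by
  obtain ⟨f, -, -, hf⟩ := b.exists_root_eq_sum_int k
  let β : Option b.support → ℤ := fun l => l.elim 0 fun l => f l
  have h1 : finPart b θ β = P.root k := by
    rw [finPart_apply, hf, ← Finset.sum_coe_sort b.support fun l => f l • P.root l]
    simp only [β, Option.elim_some, Option.elim_none, zero_mul, sub_zero]
  refine ⟨β + (c - β i) • deltaInt b θ, ?_, ?_⟩
  · rw [map_add, map_smul, finPart_deltaInt, smul_zero, add_zero, h1]
  · simp [hi]

omit [P.IsCrystallographic] in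
theorem finPart_mem_closure {i : Option b.support} {β : Option b.support → ℤ} (h0 : 0 ≤ β)
    (hi : β i = 0) :
    finPart b θ β ∈ AddSubmonoid.closure (P.root '' (extRoot b θ '' {j | j ≠ i})) := by
  rw [finPart, Fintype.linearCombination_apply, ← Finset.add_sum_erase _ _ (Finset.mem_univ i), hi,
    zero_smul, zero_add]
  exact sum_zsmul_mem_closure _ _ _ _
    (fun j hj => ⟨_, ⟨j, Finset.ne_of_mem_erase hj, rfl⟩, rfl⟩) fun j _ => h0 j

/-- As `δ_i = 1`, each root lifts to an affine root with any prescribed `i`-coordinate. Coordinate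
`0` gives the base property; coordinate `-1` makes the lift nonpositive, so that `-α_i` is highest.
-/
theorem isExtending_of_deltaInt_eq_one [Finite ι] [P.IsRootSystem] [P.IsReduced]
    (hθ : IsHighestRoot b θ) {i : Option b.support} (hi : deltaInt b θ i = 1) :
    IsExtending b θ i := by
  refine ⟨RootPairing.Base.mk' P (extRoot b θ '' {j | j ≠ i})
    ((linearIndepOn_extRoot_ne hθ i).image_of_comp _ _) fun k => ?_,
    P.reflectionPerm (extRoot b θ i) (extRoot b θ i), fun k => ?_, ?_, ?_⟩
  · obtain ⟨β, h1, h2⟩ := exists_finPart_eq_root_of_deltaInt_eq_one hi k 0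
    have hr : IsAffineRoot b θ β := ⟨k, h1.symm⟩
    rw [← h1, ← map_neg]
    exact (hr.nonneg_or_nonpos hθ).imp (fun h => finPart_mem_closure h h2)
      fun h => finPart_mem_closure (neg_nonneg.2 h) (by simp [h2])
  · obtain ⟨β, h1, h2⟩ := exists_finPart_eq_root_of_deltaInt_eq_one hi k (-1)
    have hr : IsAffineRoot b θ β := ⟨k, h1.symm⟩
    have h3 := hr.nonpos_of_neg hθ (i := i) (by omega)
    rw [P.root_reflectionPerm, P.reflection_apply_self, ← finPart_single, ← h1, ← map_neg,
      ← map_sub]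
    simp only [RootPairing.Base.mk', Set.Finite.coe_toFinset]
    refine finPart_mem_closure (fun l => ?_) (by simp [h2])
    by_cases hl : l = i
    · simp [hl, h2]
    · simpa [hl] using h3 l
  · simp [RootPairing.Base.mk']
  · rw [P.root_reflectionPerm, P.reflection_apply_self, neg_neg]

/-- The finite parts of the `x⁻¹α_i` are roots, finitely many in number, and they determine `xρ`,
hence `x`. -/
theorem finite_boxSet [Finite ι] [P.IsRootSystem] [P.IsReduced] (hθ : IsHighestRoot b θ) :
    (boxSet b θ).Finite := by
  choose f hf using fun (x : AffineWeylGroup b θ) (i : Option b.support) =>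
    isAffineRoot_rootRep_single x⁻¹ i
  refine Set.Finite.of_injOn (f := f) (t := Set.univ) (fun _ _ => Set.mem_univ _) ?_ Set.finite_univ
  intro x hx y hy h
  refine eq_of_mem_boxSet_of_affineRep_eq hθ hx hy (funext fun i => ?_)
  rw [affineRep_rho_apply, affineRep_rho_apply,
    finHeight_eq_of_finPart_eq (γ := rootRep b θ y⁻¹ (Pi.single i 1)) (by rw [← hf, ← hf, h])]

/-- There is a unique element of the box from which nothing can be fired; it is reached from all
others. -/
theorem exists_top_boxSet [Finite ι] [P.IsRootSystem] [P.IsReduced] (hθ : IsHighestRoot b θ) :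
    ∃ t ∈ boxSet b θ, (∃ i, IsExtending b θ i ∧
        affineRep b θ t (rho b θ none) = -rho b θ i) ∧
      ∀ y ∈ boxSet b θ, ∃ ω, StrictFiring (extCartan b θ) ω (affineRep b θ y (rho b θ none))
        (affineRep b θ t (rho b θ none)) := by
  have hmax : ∀ {x}, x ∈ boxSet b θ →
      (∀ y ∈ boxSet b θ, (affineSystem b θ).length y ≤ (affineSystem b θ).length x) →
      ∀ i, -1 ≤ finHeight b θ (rootRep b θ x⁻¹ (Pi.single i 1)) := by
    intro x hx h i
    by_contra! hi
    obtain ⟨h1, h2⟩ := simple_mul_mem_boxSet hθ hx hi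
    have := h _ h1
    omega
  obtain ⟨t, ht, htmax⟩ := Set.exists_max_image (boxSet b θ) (affineSystem b θ).length
    (finite_boxSet hθ) ⟨1, one_mem_boxSet hθ⟩
  obtain ⟨i, j, hform, hi⟩ := exists_isTopForm hθ ht (hmax ht htmax)
  refine ⟨t, ht, ⟨i, isExtending_of_deltaInt_eq_one hθ (hform.deltaInt_eq_one hθ),
    affineRep_rho_eq_neg_rho hθ hi⟩, fun y hy => ?_⟩
  -- Each firing reduces the distance to the maximal length; where none is possible, `y` has top
  -- form and equals `t`.
  induction hn : (affineSystem b θ).length t - (affineSystem b θ).length y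
    using Nat.strong_induction_on generalizing y with
  | _ n ih =>
    by_cases hfire : ∃ l, finHeight b θ (rootRep b θ y⁻¹ (Pi.single l 1)) < -1
    · obtain ⟨l, hl⟩ := hfire
      obtain ⟨h1, h2⟩ := simple_mul_mem_boxSet hθ hy hl
      have h3 := htmax _ h1
      obtain ⟨ω, hω⟩ := ih _ (by omega) _ h1 rfl
      exact ⟨l :: ω, StrictFiring.cons ((affineRep_rho_lt_iff y l).2 hl)
        (by rwa [fire_affineRep])⟩
    · push Not at hfire
      obtain ⟨i', j', hform', -⟩ := exists_isTopForm hθ hy hfire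
      rw [hform'.eq hθ hform]
      exact ⟨[], StrictFiring.nil _⟩

end Top

end NumbersGame

/-! ### The isomorphism with the weak order interval -/

theorem mainTheorem6 {ι M N : Type*} [Finite ι] [AddCommGroup M] [Module ℝ M]
    [AddCommGroup N] [Module ℝ N] (P : RootPairing ι ℝ M N) [P.IsRootSystem]
    [P.IsCrystallographic] [P.IsReduced] [P.IsIrreducible] (b : P.Base) (θ : ι)
    (hθ : NumbersGame.IsHighestRoot b θ) :
    ∃ φ : NumbersGame.finiteWeylPoset b θ → NumbersGame.AffineWeylGroup b θ,
      Function.Injective φ ∧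
      (∀ (w : NumbersGame.finiteWeylPoset b θ) (ω : List (Option b.support)),
        NumbersGame.StrictFiring (NumbersGame.extCartan b θ) ω (NumbersGame.rho b θ none)
            (NumbersGame.affineRep b θ w (NumbersGame.rho b θ none)) →
          φ w = (ω.map (NumbersGame.affineSystem b θ).simple).reverse.prod ∧
          (NumbersGame.affineSystem b θ).length (φ w) = ω.length) ∧
      ∃ wtop : NumbersGame.finiteWeylPoset b θ,
        (∃ i : Option b.support, NumbersGame.IsExtending b θ i ∧
          NumbersGame.affineRep b θ wtop (NumbersGame.rho b θ none) = -NumbersGame.rho b θ i) ∧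
        (∀ w : NumbersGame.finiteWeylPoset b θ, w ≠ wtop →
          (NumbersGame.affineSystem b θ).length (φ w) <
            (NumbersGame.affineSystem b θ).length (φ wtop)) ∧
        (∀ w : NumbersGame.finiteWeylPoset b θ, NumbersGame.PosetLE b θ w wtop) ∧
        Set.range φ =
          NumbersGame.leftWeakInterval (NumbersGame.affineSystem b θ) 1 (φ wtop) ∧
        ∀ w w' : NumbersGame.finiteWeylPoset b θ,
          NumbersGame.PosetLE b θ w w' ↔
            NumbersGame.LeftWeakLE (NumbersGame.affineSystem b θ) (φ w) (φ w') := by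
  open NumbersGame in
  have hone := one_mem_boxSet (b := b) hθ
  have fire_one {ω : List (Option b.support)} {v : Option b.support → ℝ}
      (h : StrictFiring (extCartan b θ) ω (rho b θ none) v) :
      firingProd b θ ω ∈ boxSet b θ ∧ affineRep b θ (firingProd b θ ω) (rho b θ none) = v ∧
        (affineSystem b θ).length (firingProd b θ ω) = ω.length := by
    have := StrictFiring.mem_boxSet hθ hone (ω := ω) (v := v) (by rw [map_one]; exact h)
    simpa using this
  have hex : ∀ w : finiteWeylPoset b θ, ∃ x ∈ boxSet b θ,
      affineRep b θ x (rho b θ none) = affineRep b θ w (rho b θ none) := by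
    rintro ⟨w, hw, ω, hω⟩
    exact ⟨_, (fire_one hω).1, (fire_one hω).2.1⟩
  -- `φ w` is the box element with the same image of `ρ` as `w`; its uniqueness makes the product
  -- independent of the firing sequence.
  choose φ hφ hφρ using hex
  have hinj : Function.Injective φ := by
    intro w w' h
    refine Subtype.ext (eq_of_mem_finiteWeyl_of_affineRep_eq hθ w.2.1 w'.2.1 ?_)
    rw [← hφρ, ← hφρ, h]
  have hφeq {w : finiteWeylPoset b θ} {x : AffineWeylGroup b θ} (hx : x ∈ boxSet b θ)
      (h : affineRep b θ x (rho b θ none) = affineRep b θ w (rho b θ none)) : φ w = x :=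
    eq_of_mem_boxSet_of_affineRep_eq hθ (hφ w) hx ((hφρ w).trans h.symm)
  -- The image of `φ` is the whole box: `1 ≤_L x` supplies the firing sequence leading to `xρ`.
  have hsurj {x : AffineWeylGroup b θ} (hx : x ∈ boxSet b θ) : ∃ w, φ w = x := by
    obtain ⟨w, hw, h⟩ := exists_mem_finiteWeyl_affineRep x
    have h1 := (exists_strictFiring_of_leftWeakLE hθ hx (leftWeakLE_one x)).2
    rw [map_one] at h1
    exact ⟨⟨w, hw, by rw [h]; exact h1⟩, hφeq hx h.symm⟩
  have hle (w w' : finiteWeylPoset b θ) :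
      PosetLE b θ w w' ↔ LeftWeakLE (affineSystem b θ) (φ w) (φ w') := by
    rw [PosetLE, ← hφρ, ← hφρ]
    refine ⟨fun ⟨ω, hω⟩ => ?_, fun h => (exists_strictFiring_of_leftWeakLE hθ (hφ w') h).2⟩
    obtain ⟨h1, h2, h3⟩ := hω.mem_boxSet hθ (hφ w)
    rw [← eq_of_mem_boxSet_of_affineRep_eq hθ h1 (hφ w') h2]
    exact leftWeakLE_firingProd_mul h3
  obtain ⟨t, ht, ⟨i, hi, hti⟩, htop⟩ := exists_top_boxSet hθ
  obtain ⟨wtop, rfl⟩ := hsurj ht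
  have hletop (w : finiteWeylPoset b θ) : PosetLE b θ w wtop := by
    rw [PosetLE, ← hφρ, ← hφρ]
    exact htop _ (hφ w)
  refine ⟨φ, hinj, fun w ω hω => ?_, wtop, ⟨i, hi, by rw [← hφρ, hti]⟩, fun w hw => ?_, hletop, ?_,
    hle⟩
  · obtain ⟨h1, h2, h3⟩ := fire_one hω
    rw [hφeq h1 h2]
    exact ⟨rfl, h3⟩
  · have h1 := (hle w wtop).1 (hletop w)
    have h2 : (affineSystem b θ).length (φ wtop * (φ w)⁻¹) ≠ 0 := by
      rw [ne_eq, (affineSystem b θ).length_eq_zero_iff, mul_inv_eq_one]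
      exact fun h => hw (hinj h).symm
    rw [LeftWeakLE] at h1
    omega
  · ext x
    constructor
    · rintro ⟨w, rfl⟩
      exact ⟨leftWeakLE_one _, (hle w wtop).1 (hletop w)⟩
    · rintro ⟨-, hx⟩
      exact hsurj (exists_strictFiring_of_leftWeakLE hθ ht hx).1
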